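/- Let $n\ge 2$, $1\le s<\frac{n}{n-1}$, and let $D\subset\mathbb R^n$ be an $s$-John domain with John center $x_0$; that is, $D$ is a bounded domain, $x_0\in D$, and there are constants $0<\alpha\le\beta<\infty$ such that every $x\in D$ can be joined to $x_0$ by a rectifiable curve $\gamma_x:[0,\ell(\gamma_x)]\to D$ parametrized by arc length with $\gamma_x(0)=x$, $\gamma_x(\ell(\gamma_x))=x_0$, $\ell(\gamma_x)\le\beta$ and $t^s\le\frac{\beta}{\alpha}\operatorname{dist}(\gamma_x(t),\partial D)$ for all $t\in[0,\ell(\gamma_x)]$. Put $B:=B(x_0,\operatorname{dist}(x_0,\partial D))$ and $p:=\frac{n}{n-s(n-1)}$. Then there exist constants $a,b>0$ such that every $u\in W^{1,1}_{\mathrm{loc}}(D)$ with distributional gradient satisfying $\|\nabla u\|_{L^{p}(D)}\le 1$ is integrable on $B$, and, with $u_B:=\frac1{|B|}\int_B u\,dx$, \[ \int_D \exp\Big(a\,|u-u_B|^{\frac{n}{s(n-1)}}\Big)\,d\mathcal H_\infty^{s(n-1)}\le b . \] Here $\mathcal H^{d}_\infty(E):=\inf\big\{\sum_{i=1}^\infty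 r_i^{d}: E\subset\bigcup_{i=1}^\infty B(x_i,r_i)\big\}$ is the Hausdorff content, the integral is the Choquet integral $\int_D|f|\,d\mathcal H^d_\infty:=\int_0^\infty\mathcal H^d_\infty(\{x\in D:|f(x)|>t\})\,dt$, and in the integrand $u$ denotes any precise representative of the Sobolev function, i.e. one whose value at each Lebesgue point $x\in D$ (each $x$ for which there is $c\in\mathbb R$ with $\frac1{|B(x,r)|}\int_{B(x,r)}|u-c|\,dy\to0$ as $r\to0^+$) is the corresponding $c$; its values at other points are arbitrary. -/

import Mathlib

open MeasureTheory Set Filter Topology Metric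
open scoped ENNReal NNReal ContDiff

/-- `D ⊆ ℝⁿ` is a (bounded) `s`-John domain with John center `x₀`: every `x ∈ D` is joined to `x₀`
inside `D` by a rectifiable curve `γ : [0, ℓ] → D` parametrized by arc length, with `ℓ ≤ β` and
`t ^ s ≤ (β / α) dist (γ t, ∂D)`, where `α, β` do not depend on `x`. -/
def IsJohnDomainWithCenter {n : ℕ} (s : ℝ) (D : Set (EuclideanSpace ℝ (Fin n)))
    (x₀ : EuclideanSpace ℝ (Fin n)) : Prop :=
  IsOpen D ∧ IsConnected D ∧ Bornology.IsBounded D ∧ x₀ ∈ D ∧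
    ∃ α β : ℝ, 0 < α ∧ α ≤ β ∧
      ∀ x ∈ D, ∃ (ℓ : ℝ) (γ : ℝ → EuclideanSpace ℝ (Fin n)),
        0 ≤ ℓ ∧ ℓ ≤ β ∧ HasUnitSpeedOn γ (Icc 0 ℓ) ∧ MapsTo γ (Icc 0 ℓ) D ∧
        γ 0 = x ∧ γ ℓ = x₀ ∧
        ∀ t ∈ Icc 0 ℓ, t ^ s ≤ β / α * infDist (γ t) (frontier D)

/-- The `d`-dimensional Hausdorff content `inf {∑ rᵢ ^ d : E ⊆ ⋃ B(xᵢ, rᵢ)}`, the balls being open.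
For `d > 0`, finite covers are included through balls of radius `0`. -/
noncomputable def hausdorffContent {n : ℕ} (d : ℝ) (E : Set (EuclideanSpace ℝ (Fin n))) : ℝ≥0∞ :=
  ⨅ (x : ℕ → EuclideanSpace ℝ (Fin n)) (r : ℕ → ℝ≥0) (_ : E ⊆ ⋃ i, ball (x i) (r i)),
    ∑' i, (r i : ℝ≥0∞) ^ d

/-- The Choquet integral `∫_D |f| dH_∞^d = ∫_0^∞ H_∞^d {x ∈ D : |f x| > t} dt`. -/
noncomputable def choquetIntegral {n : ℕ} (d : ℝ) (D : Set (EuclideanSpace ℝ (Fin n)))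
    (f : EuclideanSpace ℝ (Fin n) → ℝ) : ℝ≥0∞ :=
  ∫⁻ t in Ioi (0 : ℝ), hausdorffContent d {x ∈ D | t < |f x|}

/-- `u ∈ W^{1,1}_loc(D)` and `g` is its distributional gradient in the open set `D`. -/
def HasWeakGradientOn {n : ℕ} (D : Set (EuclideanSpace ℝ (Fin n)))
    (u : EuclideanSpace ℝ (Fin n) → ℝ)
    (g : EuclideanSpace ℝ (Fin n) → EuclideanSpace ℝ (Fin n)) : Prop :=
  LocallyIntegrableOn u D ∧ LocallyIntegrableOn g D ∧
    ∀ φ : EuclideanSpace ℝ (Fin n) → ℝ, ContDiff ℝ ∞ φ → HasCompactSupport φ → tsupport φ ⊆ D →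
      ∀ w : EuclideanSpace ℝ (Fin n),
        ∫ x in D, u x * fderiv ℝ φ x w = - ∫ x in D, φ x * inner ℝ (g x) w

/-- `v` is a precise representative of `u` in the open set `D`: at every Lebesgue point `x ∈ D` of
`u`, i.e. whenever `⨍_{B(x,r)} |u - c| → 0` as `r → 0` for some `c`, one has `v x = c`. No condition
is put on `v` at the remaining points of `D`, which form a Lebesgue null set when `u` is locally
integrable. The Hausdorff content of the level sets depends on the values of a Sobolev function on
Lebesgue null sets, so that a pointwise representative has to be specified. -/
def IsPreciseRepresentativeOn {n : ℕ} (D : Set (EuclideanSpace ℝ (Fin n)))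
    (u v : EuclideanSpace ℝ (Fin n) → ℝ) : Prop :=
  ∀ x ∈ D, ∀ c : ℝ,
    Tendsto (fun r : ℝ => ⨍ y in ball x r, |u y - c|) (𝓝[>] 0) (𝓝 0) → v x = c

/-!
Write `d = s (n - 1)`, `p = n / (n - d)` and `q = n / d`, which are conjugate exponents. Cut a John
curve for `x` into arcs contained in `B(x, A 2 ^ (-j))`. Balls of radius `r ≈ 2 ^ (-s j)` centred on
the `j`-th arc lie in `D`, and by the Poincaré inequality the average of `u` oscillates by
`O(r ^ (1 - n) ∫ |∇u|)` from one of them to an overlapping one. Centres forming a maximal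
`r`-separated subset of the arc suffice, and their balls overlap boundedly often, so that the arc
contributes `O(2 ^ (d j) ∫_{B(x, A 2 ^ (-j)) ∩ D} |∇u|)` however many balls are needed. Thus
`|u x - u_B|` is bounded by a constant plus a multiple of the dyadic potential of `|∇u|`.

By Hölder's inequality the first `J` terms of that potential are together `O(J ^ (1 / q))`. The rest
decay geometrically unless `x` is a point around which `|∇u| ^ p` concentrates at some scale below
`A 2 ^ (-J)`; by Vitali's covering lemma such points have Hausdorff content `O(2 ^ (-d J))`. Hence
`|u - u_B| ^ q` exceeds a multiple of `J` only on a set of exponentially small content.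
-/

section SmoothPoincare

variable {E : Type*} [NormedAddCommGroup E] [NormedSpace ℝ E]

theorem enorm_sub_le_lintegral_fderiv_segment {w : E → ℝ} (hw : ContDiff ℝ 1 w) (x y : E) :
    ‖w x - w y‖ₑ ≤ ‖x - y‖ₑ * ∫⁻ t in Icc (0 : ℝ) 1, ‖fderiv ℝ w ((1 - t) • x + t • y)‖ₑ := by
  have hderiv (t : ℝ) : HasDerivAt (fun t : ℝ => w ((1 - t) • x + t • y))
      (fderiv ℝ w ((1 - t) • x + t • y) (y - x)) t := by
    have hsegment : HasDerivAt (fun t : ℝ => (1 - t) • x + t • y) (y - x) t := by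
      rw [show y - x = (-1 : ℝ) • x + (1 : ℝ) • y by rw [neg_smul, one_smul, one_smul]; abel]
      exact (((hasDerivAt_id t).const_sub 1).smul_const x).add ((hasDerivAt_id t).smul_const y)
    exact (hw.differentiable one_ne_zero _).hasFDerivAt.comp_hasDerivAt t hsegment
  have hcontDiff : ContDiff ℝ 1 (fun t : ℝ => w ((1 - t) • x + t • y)) := by fun_prop
  have hle := enorm_sub_le_lintegral_deriv_of_contDiffOn_Icc
    (hcontDiff.contDiffOn (s := Icc 0 1)) zero_le_one
  simp only [sub_self, zero_smul, one_smul, zero_add, sub_zero, add_zero] at hle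
  rw [← enorm_neg (w x - w y), neg_sub, ← lintegral_const_mul' _ _ enorm_ne_top]
  refine hle.trans (lintegral_mono fun t => ?_)
  rw [(hderiv t).deriv, mul_comm, ← enorm_neg (x - y), neg_sub]
  exact ContinuousLinearMap.le_opENorm _ _

variable [FiniteDimensional ℝ E] [MeasurableSpace E] [BorelSpace E]

theorem setLIntegral_comp_homothety_le (μ : Measure E) [μ.IsAddHaarMeasure] (G : E → ℝ≥0∞)
    {a : ℝ} (ha : 0 < a) (c : E) {s t : Set E} (hs : MeasurableSet s) (ht : MeasurableSet t)
    (hst : ∀ x ∈ s, a • x + c ∈ t) :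
    ∫⁻ x in s, G (a • x + c) ∂μ
      ≤ ENNReal.ofReal ((a ^ Module.finrank ℝ E)⁻¹) * ∫⁻ x in t, G x ∂μ := by
  calc ∫⁻ x in s, G (a • x + c) ∂μ
      ≤ ∫⁻ x, t.indicator G (a • x + c) ∂μ := by
        rw [← lintegral_indicator hs]
        refine lintegral_mono fun x => ?_
        by_cases hx : x ∈ s
        · simp [hx, hst x hx]
        · simp [hx]
    _ = ∫⁻ y, t.indicator G (y + c) ∂(Measure.map (a • ·) μ) :=
        ((Homeomorph.smulOfNeZero a ha.ne').measurableEmbedding.lintegral_map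
          (fun y => t.indicator G (y + c))).symm
    _ = ENNReal.ofReal ((a ^ Module.finrank ℝ E)⁻¹) * ∫⁻ x in t, G x ∂μ := by
        rw [Measure.map_addHaar_smul μ ha.ne', lintegral_smul_measure, smul_eq_mul,
          lintegral_add_right_eq_self (fun y => t.indicator G y) c, lintegral_indicator ht,
          abs_of_nonneg (by positivity)]

theorem setLIntegral_comp_segment_le (μ : Measure E) [μ.IsAddHaarMeasure] (G : E → ℝ≥0∞)
    {s : Set E} (hs : Convex ℝ s) (hsm : MeasurableSet s) {t : ℝ} (ht : t ∈ Icc (1 / 2 : ℝ) 1)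
    {x : E} (hx : x ∈ s) :
    ∫⁻ y in s, G ((1 - t) • x + t • y) ∂μ ≤ 2 ^ Module.finrank ℝ E * ∫⁻ y in s, G y ∂μ := by
  have ht0 : 0 < t := by linarith [ht.1]
  have hmaps : ∀ y ∈ s, t • y + (1 - t) • x ∈ s := fun y hy =>
    hs hy hx ht0.le (by linarith [ht.2]) (by ring)
  have hfactor : ENNReal.ofReal ((t ^ Module.finrank ℝ E)⁻¹) ≤ 2 ^ Module.finrank ℝ E := by
    rw [← inv_pow, ENNReal.ofReal_pow (by positivity)]
    gcongr
    rw [← ENNReal.ofReal_ofNat 2]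
    exact ENNReal.ofReal_le_ofReal ((inv_le_comm₀ ht0 two_pos).2 (by linarith [ht.1]))
  simp only [add_comm ((1 - t) • x)]
  exact (setLIntegral_comp_homothety_le μ G ht0 _ hsm hsm hmaps).trans (by gcongr)

-- One of `t` and `1 - t` is at least `1 / 2`; that endpoint is the one to integrate over first.
theorem lintegral_lintegral_comp_segment_le (μ : Measure E) [μ.IsAddHaarMeasure] {G : E → ℝ≥0∞}
    (hG : Measurable G) {s : Set E} (hs : Convex ℝ s) (hsm : MeasurableSet s) {t : ℝ}
    (ht : t ∈ Icc (0 : ℝ) 1) :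
    ∫⁻ x in s, ∫⁻ y in s, G ((1 - t) • x + t • y) ∂μ ∂μ
      ≤ 2 ^ Module.finrank ℝ E * μ s * ∫⁻ y in s, G y ∂μ := by
  have integrate_inner_bound {H : E → ℝ≥0∞}
      (hH : ∀ x ∈ s, H x ≤ 2 ^ Module.finrank ℝ E * ∫⁻ y in s, G y ∂μ) :
      ∫⁻ x in s, H x ∂μ ≤ 2 ^ Module.finrank ℝ E * μ s * ∫⁻ y in s, G y ∂μ := by
    refine (setLIntegral_mono measurable_const hH).trans_eq ?_
    rw [setLIntegral_const, mul_right_comm]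
  rcases le_total (1 / 2) t with h | h
  · exact integrate_inner_bound fun x hx => setLIntegral_comp_segment_le μ G hs hsm ⟨h, ht.2⟩ hx
  · rw [lintegral_lintegral_swap (by
      exact (hG.comp (by fun_prop : Continuous fun q : E × E =>
        (1 - t) • q.1 + t • q.2).measurable).aemeasurable)]
    refine integrate_inner_bound fun y hy => ?_
    have hswap := setLIntegral_comp_segment_le μ G hs hsm (t := 1 - t)
      ⟨by linarith, by linarith [ht.1]⟩ hy
    simpa only [sub_sub_cancel, add_comm] using hswap

theorem lintegral_lintegral_enorm_sub_le_of_contDiff (μ : Measure E) [μ.IsAddHaarMeasure]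
    {w : E → ℝ} (hw : ContDiff ℝ 1 w) {s : Set E} (hs : Convex ℝ s) (hsm : MeasurableSet s)
    (hsb : Bornology.IsBounded s) :
    ∫⁻ x in s, ∫⁻ y in s, ‖w x - w y‖ₑ ∂μ ∂μ
      ≤ ediam s * (2 ^ Module.finrank ℝ E * μ s * ∫⁻ x in s, ‖fderiv ℝ w x‖ₑ ∂μ) := by
  set F : E → ℝ≥0∞ := fun x => ‖fderiv ℝ w x‖ₑ
  have hF : Measurable F := (hw.continuous_fderiv one_ne_zero).enorm.measurable
  have hpath : Measurable fun q : (E × ℝ) × E => F ((1 - q.1.2) • q.1.1 + q.1.2 • q.2) :=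
    hF.comp (by fun_prop : Continuous fun q : (E × ℝ) × E =>
      (1 - q.1.2) • q.1.1 + q.1.2 • q.2).measurable
  calc ∫⁻ x in s, ∫⁻ y in s, ‖w x - w y‖ₑ ∂μ ∂μ
      ≤ ∫⁻ x in s, ∫⁻ y in s, ediam s *
          (∫⁻ t in Icc (0 : ℝ) 1, F ((1 - t) • x + t • y)) ∂μ ∂μ := by
        refine setLIntegral_mono' hsm fun x hx => setLIntegral_mono' hsm fun y hy => ?_
        refine (enorm_sub_le_lintegral_fderiv_segment hw x y).trans ?_
        gcongr
        rw [← edist_eq_enorm_sub]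
        exact edist_le_ediam_of_mem hx hy
    _ = ediam s * ∫⁻ x in s, ∫⁻ y in s,
          (∫⁻ t in Icc (0 : ℝ) 1, F ((1 - t) • x + t • y)) ∂μ ∂μ := by
        simp_rw [lintegral_const_mul' _ _ hsb.ediam_ne_top]
    _ = ediam s * ∫⁻ t in Icc (0 : ℝ) 1, ∫⁻ x in s, ∫⁻ y in s,
          F ((1 - t) • x + t • y) ∂μ ∂μ := by
        congr 1
        have hinner (x : E) : ∫⁻ y in s, (∫⁻ t in Icc (0 : ℝ) 1, F ((1 - t) • x + t • y)) ∂μ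
            = ∫⁻ t in Icc (0 : ℝ) 1, ∫⁻ y in s, F ((1 - t) • x + t • y) ∂μ :=
          lintegral_lintegral_swap
            (hpath.comp (by fun_prop : Measurable fun q : E × ℝ => ((x, q.2), q.1))).aemeasurable
        simp_rw [hinner]
        exact lintegral_lintegral_swap hpath.lintegral_prod_right'.aemeasurable
    _ ≤ ediam s * ∫⁻ t in Icc (0 : ℝ) 1,
          2 ^ Module.finrank ℝ E * μ s * ∫⁻ x in s, F x ∂μ := by
        gcongr ediam s * ?_
        exact setLIntegral_mono' measurableSet_Icc fun t ht =>
          lintegral_lintegral_comp_segment_le μ hF hs hsm ht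
    _ = _ := by rw [setLIntegral_const]; simp

end SmoothPoincare

section Mollification

variable {E : Type*} [NormedAddCommGroup E]

theorem exists_seq_contDiffBump {δ : ℝ} (hδ : 0 < δ) :
    ∃ φ : ℕ → ContDiffBump (0 : E), (∀ i, (φ i).rOut ≤ δ) ∧ (∀ i, (φ i).rOut ≤ 2 * (φ i).rIn) ∧
      Tendsto (fun i => (φ i).rOut) atTop (𝓝 0) := by
  have hpos (i : ℕ) : 0 < δ / (i + 1) := by positivity
  refine ⟨fun i => ⟨δ / (i + 1) / 2, δ / (i + 1), half_pos (hpos i), half_lt_self (hpos i)⟩,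
    fun i => div_le_self hδ.le (by simp), fun i => (mul_div_cancel₀ _ two_ne_zero).ge, ?_⟩
  simpa [div_eq_mul_inv] using
    (tendsto_one_div_add_atTop_nhds_zero_nat (𝕜 := ℝ)).const_mul δ

variable [NormedSpace ℝ E] [FiniteDimensional ℝ E] [MeasurableSpace E] [BorelSpace E]
  {μ : Measure E} [μ.IsAddHaarMeasure]

/-- The mollification `φ ∗ f` of `f`, the bump function `φ` being normalized to have integral `1`
with respect to `μ`. -/
noncomputable def mollify (μ : Measure E) (φ : ContDiffBump (0 : E)) (f : E → ℝ) : E → ℝ :=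
  convolution (φ.normed μ) f (ContinuousLinearMap.lsmul ℝ ℝ) μ

theorem contDiff_mollify (φ : ContDiffBump (0 : E)) {f : E → ℝ} (hf : LocallyIntegrable f μ) :
    ContDiff ℝ 1 (mollify μ φ f) :=
  φ.hasCompactSupport_normed.contDiff_convolution_left _ (φ.contDiff_normed (n := 1)) hf

theorem tsupport_normed_comp_const_sub_subset (φ : ContDiffBump (0 : E)) (x : E) :
    tsupport (fun y => φ.normed μ (x - y)) ⊆ closedBall x φ.rOut := by
  refine closure_minimal (fun y hy => ?_) isClosed_closedBall
  have hmem : x - y ∈ tsupport (φ.normed μ) := subset_tsupport _ hy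
  rwa [φ.tsupport_normed_eq, mem_closedBall_zero_iff, ← dist_eq_norm, dist_comm] at hmem

theorem fderiv_mollify_apply (φ : ContDiffBump (0 : E)) {f : E → ℝ} (hf : LocallyIntegrable f μ)
    (x w : E) :
    fderiv ℝ (mollify μ φ f) x w
      = -∫ y, f y * fderiv ℝ (fun y => φ.normed μ (x - y)) y w ∂μ := by
  have hsmooth : ContDiff ℝ 1 (φ.normed μ) := φ.contDiff_normed (n := 1)
  have hcompact : HasCompactSupport (φ.normed μ) := φ.hasCompactSupport_normed
  have hreflect (y : E) :
      fderiv ℝ (fun y => φ.normed μ (x - y)) y = -fderiv ℝ (φ.normed μ) (x - y) := by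
    have hcomp := (hsmooth.differentiable one_ne_zero (x - y)).hasFDerivAt.comp y
      ((hasFDerivAt_id y).const_sub x)
    ext v
    simp [show fderiv ℝ (fun y => φ.normed μ (x - y)) y = _ from hcomp.fderiv]
  have hflip : mollify μ φ f
      = convolution f (φ.normed μ) (ContinuousLinearMap.lsmul ℝ ℝ).flip μ :=
    (convolution_flip _).symm
  rw [hflip, (hcompact.hasFDerivAt_convolution_right _ hf hsmooth x).fderiv,
    convolution_precompR_apply _ hf (hcompact.fderiv ℝ)
      (hsmooth.continuous_fderiv one_ne_zero), ← integral_neg]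
  simp only [convolution_def, hreflect, ContinuousLinearMap.flip_apply,
    ContinuousLinearMap.lsmul_apply, smul_eq_mul, neg_apply, mul_neg, neg_neg, mul_comm]

theorem lintegral_enorm_normed_sub_eq_one (φ : ContDiffBump (0 : E)) (y : E) :
    ∫⁻ x, ‖φ.normed μ (x - y)‖ₑ ∂μ = 1 := by
  rw [lintegral_sub_right_eq_self (fun x => ‖φ.normed μ x‖ₑ) y]
  simp_rw [Real.enorm_of_nonneg (φ.nonneg_normed _)]
  rw [← ofReal_integral_eq_lintegral_ofReal φ.integrable_normed (ae_of_all _ φ.nonneg_normed),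
    φ.integral_normed, ENNReal.ofReal_one]

end Mollification

theorem lintegral_lintegral_enorm_sub_le_of_tendsto {X : Type*} [MeasurableSpace X]
    {μ : Measure X} [SFinite μ] {f : X → ℝ} {F : ℕ → X → ℝ} (hF : ∀ i, Measurable (F i))
    (hlim : ∀ᵐ x ∂μ, Tendsto (fun i => F i x) atTop (𝓝 (f x))) {C : ℝ≥0∞}
    (hC : ∀ i, ∫⁻ x, ∫⁻ y, ‖F i x - F i y‖ₑ ∂μ ∂μ ≤ C) :
    ∫⁻ x, ∫⁻ y, ‖f x - f y‖ₑ ∂μ ∂μ ≤ C := by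
  have hmeas (i : ℕ) : Measurable fun q : X × X => ‖F i q.1 - F i q.2‖ₑ :=
    (((hF i).comp measurable_fst).sub ((hF i).comp measurable_snd)).enorm
  calc ∫⁻ x, ∫⁻ y, ‖f x - f y‖ₑ ∂μ ∂μ
      ≤ ∫⁻ x, liminf (fun i => ∫⁻ y, ‖F i x - F i y‖ₑ ∂μ) atTop ∂μ := by
        refine lintegral_mono_ae ?_
        filter_upwards [hlim] with x hx
        calc ∫⁻ y, ‖f x - f y‖ₑ ∂μ
            = ∫⁻ y, liminf (fun i => ‖F i x - F i y‖ₑ) atTop ∂μ := by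
              refine lintegral_congr_ae ?_
              filter_upwards [hlim] with y hy
              exact (hx.sub hy).enorm.liminf_eq.symm
          _ ≤ _ := lintegral_liminf_le fun i => (hmeas i).comp measurable_prodMk_left
    _ ≤ liminf (fun i => ∫⁻ x, ∫⁻ y, ‖F i x - F i y‖ₑ ∂μ ∂μ) atTop :=
        lintegral_liminf_le fun i => (hmeas i).lintegral_prod_right'
    _ ≤ C := liminf_le_of_le (by isBoundedDefault) fun b hb =>
        hb.exists.elim fun i hi => hi.trans (hC i)

theorem setLIntegral_ball_le_of_forall_lt {X : Type*} [PseudoMetricSpace X] [MeasurableSpace X]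
    {μ : Measure X} {f : X → ℝ≥0∞} {z : X} {R : ℝ} {C : ℝ≥0∞}
    (h : ∀ r < R, ∫⁻ x in ball z r, f x ∂μ ≤ C) : ∫⁻ x in ball z R, f x ∂μ ≤ C := by
  have hunion : ball z R = ⋃ q : {q : ℚ // (q : ℝ) < R}, ball z (q : ℚ) := by
    ext x
    simp only [mem_iUnion, mem_ball, Subtype.exists, exists_prop]
    constructor
    · intro hx
      obtain ⟨q, hxq, hqR⟩ := exists_rat_btwn hx
      exact ⟨q, hqR, hxq⟩
    · rintro ⟨q, hqR, hxq⟩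
      exact hxq.trans hqR
  have hmono : Monotone fun q : {q : ℚ // (q : ℝ) < R} => ball z (q : ℚ) :=
    fun _ _ hqr => ball_subset_ball (by exact_mod_cast hqr)
  rw [hunion, setLIntegral_iUnion_of_directed _ hmono.directed_le]
  exact iSup_le fun q => h q q.2

namespace HasWeakGradientOn

variable {n : ℕ} {D : Set (EuclideanSpace ℝ (Fin n))} {u : EuclideanSpace ℝ (Fin n) → ℝ}
  {g : EuclideanSpace ℝ (Fin n) → EuclideanSpace ℝ (Fin n)}

theorem locallyIntegrable_indicator (h : HasWeakGradientOn D u g)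
    {K : Set (EuclideanSpace ℝ (Fin n))} (hK : IsCompact K) (hKD : K ⊆ D) :
    LocallyIntegrable (K.indicator u) :=
  ((integrable_indicator_iff hK.measurableSet).2
    (h.1.integrableOn_compact_subset hKD hK)).locallyIntegrable

theorem fderiv_mollify_indicator_apply (h : HasWeakGradientOn D u g)
    (φ : ContDiffBump (0 : EuclideanSpace ℝ (Fin n)))
    {K : Set (EuclideanSpace ℝ (Fin n))} (hK : IsCompact K) (hKD : K ⊆ D)
    {x : EuclideanSpace ℝ (Fin n)} (hx : closedBall x φ.rOut ⊆ K)
    (w : EuclideanSpace ℝ (Fin n)) :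
    fderiv ℝ (mollify volume φ (K.indicator u)) x w
      = ∫ y in D, φ.normed volume (x - y) * inner ℝ (g y) w := by
  have hsupport := tsupport_normed_comp_const_sub_subset (μ := volume) φ x
  have hsmooth : ContDiff ℝ ∞ fun y => φ.normed volume (x - y) :=
    (φ.contDiff_normed (n := ⊤)).comp (contDiff_const.sub contDiff_id)
  have hcompact : HasCompactSupport fun y => φ.normed volume (x - y) :=
    .of_support_subset_isCompact (isCompact_closedBall x φ.rOut)
      ((subset_tsupport _).trans hsupport)
  have hzero {y : EuclideanSpace ℝ (Fin n)} (hy : y ∉ K) :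
      fderiv ℝ (fun y => φ.normed volume (x - y)) y = 0 :=
    image_eq_zero_of_notMem_tsupport fun hmem =>
      hy (hx (hsupport (tsupport_fderiv_subset ℝ hmem)))
  have hweak := h.2.2 _ hsmooth hcompact (hsupport.trans (hx.trans hKD)) w
  rw [fderiv_mollify_apply φ (h.locallyIntegrable_indicator hK hKD), neg_eq_iff_eq_neg, ← hweak,
    ← setIntegral_eq_integral_of_forall_compl_eq_zero (s := D)]
  · refine integral_congr_ae (ae_of_all _ fun y => ?_)
    by_cases hy : y ∈ K
    · simp only [indicator_of_mem hy]
    · simp [hzero hy]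
  · intro y hy
    simp [hzero fun hyK => hy (hKD hyK)]

theorem enorm_fderiv_mollify_indicator_le (h : HasWeakGradientOn D u g)
    (φ : ContDiffBump (0 : EuclideanSpace ℝ (Fin n)))
    {K : Set (EuclideanSpace ℝ (Fin n))} (hK : IsCompact K) (hKD : K ⊆ D)
    {x : EuclideanSpace ℝ (Fin n)} (hx : closedBall x φ.rOut ⊆ K) :
    ‖fderiv ℝ (mollify volume φ (K.indicator u)) x‖ₑ
      ≤ ∫⁻ y in K, ‖φ.normed volume (x - y)‖ₑ * ‖g y‖ₑ := by
  refine ContinuousLinearMap.opENorm_le_bound _ fun w => ?_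
  rw [h.fderiv_mollify_indicator_apply φ hK hKD hx]
  calc ‖∫ y in D, φ.normed volume (x - y) * inner ℝ (g y) w‖ₑ
      ≤ ∫⁻ y in D, ‖φ.normed volume (x - y) * inner ℝ (g y) w‖ₑ :=
        enorm_integral_le_lintegral_enorm _
    _ ≤ ∫⁻ y, K.indicator (fun y => ‖φ.normed volume (x - y)‖ₑ * ‖g y‖ₑ * ‖w‖ₑ) y := by
        refine (setLIntegral_le_lintegral _ _).trans (lintegral_mono fun y => ?_)
        by_cases hy : y ∈ K
        · simp only [indicator_of_mem hy, enorm_mul, mul_assoc]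
          gcongr
          simp only [enorm_eq_nnnorm, ← ENNReal.coe_mul]
          exact_mod_cast nnnorm_inner_le_nnnorm (𝕜 := ℝ) (g y) w
        · have hvanish : φ.normed volume (x - y) = 0 :=
            image_eq_zero_of_notMem_tsupport (f := fun y => φ.normed volume (x - y))
              fun hmem => hy (hx (tsupport_normed_comp_const_sub_subset φ x hmem))
          simp [hvanish]
    _ = (∫⁻ y in K, ‖φ.normed volume (x - y)‖ₑ * ‖g y‖ₑ) * ‖w‖ₑ := by
        rw [lintegral_indicator hK.measurableSet, lintegral_mul_const' _ _ enorm_ne_top]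

theorem lintegral_enorm_fderiv_mollify_le (h : HasWeakGradientOn D u g)
    (φ : ContDiffBump (0 : EuclideanSpace ℝ (Fin n)))
    {s K : Set (EuclideanSpace ℝ (Fin n))} (hs : MeasurableSet s) (hK : IsCompact K) (hKD : K ⊆ D)
    (hsK : ∀ x ∈ s, closedBall x φ.rOut ⊆ K) :
    ∫⁻ x in s, ‖fderiv ℝ (mollify volume φ (K.indicator u)) x‖ₑ ≤ ∫⁻ x in K, ‖g x‖ₑ := by
  have hg : AEMeasurable (fun x => ‖g x‖ₑ) (volume.restrict K) :=
    (h.2.1.integrableOn_compact_subset hKD hK).aestronglyMeasurable.enorm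
  have hφ : Measurable (φ.normed volume) := φ.continuous_normed.measurable
  calc ∫⁻ x in s, ‖fderiv ℝ (mollify volume φ (K.indicator u)) x‖ₑ
      ≤ ∫⁻ x in s, ∫⁻ y in K, ‖φ.normed volume (x - y)‖ₑ * ‖g y‖ₑ :=
        setLIntegral_mono' hs fun x hx =>
          h.enorm_fderiv_mollify_indicator_le φ hK hKD (hsK x hx)
    _ ≤ ∫⁻ x, ∫⁻ y in K, ‖φ.normed volume (x - y)‖ₑ * ‖g y‖ₑ := setLIntegral_le_lintegral _ _
    _ = ∫⁻ y in K, ∫⁻ x, ‖φ.normed volume (x - y)‖ₑ * ‖g y‖ₑ :=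
        lintegral_lintegral_swap
          ((hφ.comp (measurable_fst.sub measurable_snd)).enorm.aemeasurable.mul hg.comp_snd)
    _ = ∫⁻ y in K, ‖g y‖ₑ := by
        refine lintegral_congr fun y => ?_
        rw [lintegral_mul_const' _ _ enorm_ne_top, lintegral_enorm_normed_sub_eq_one, one_mul]

theorem lintegral_lintegral_enorm_sub_le_of_lt (h : HasWeakGradientOn D u g)
    {z : EuclideanSpace ℝ (Fin n)} {r R : ℝ} (hr : r < R) (hD : closedBall z R ⊆ D) :
    ∫⁻ x in ball z r, ∫⁻ y in ball z r, ‖u x - u y‖ₑ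
      ≤ ENNReal.ofReal (2 * r) *
        (2 ^ n * volume (ball z r) * ∫⁻ x in closedBall z R, ‖g x‖ₑ) := by
  obtain ⟨φ, hφR, hφ2, hφ0⟩ := exists_seq_contDiffBump
    (E := EuclideanSpace ℝ (Fin n)) (sub_pos.2 hr)
  have hloc := h.locallyIntegrable_indicator (isCompact_closedBall z R) hD
  have hlim : ∀ᵐ x ∂(volume.restrict (ball z r)),
      Tendsto (fun i => mollify volume (φ i) ((closedBall z R).indicator u) x) atTop
        (𝓝 (u x)) := by
    rw [ae_restrict_iff' measurableSet_ball]
    filter_upwards [ContDiffBump.ae_convolution_tendsto_right_of_locallyIntegrable hφ0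
      (Eventually.of_forall hφ2) hloc] with x hx hxr
    rwa [indicator_of_mem (ball_subset_closedBall (ball_subset_ball hr.le hxr))] at hx
  refine lintegral_lintegral_enorm_sub_le_of_tendsto
    (fun i => (contDiff_mollify (φ i) hloc).continuous.measurable) hlim fun i => ?_
  refine (lintegral_lintegral_enorm_sub_le_of_contDiff volume (contDiff_mollify (φ i) hloc)
    (convex_ball z r) measurableSet_ball isBounded_ball).trans ?_
  rw [finrank_euclideanSpace_fin]
  gcongr ?_ * (_ * ?_)
  · rw [← eball_ofReal, ENNReal.ofReal_mul two_pos.le, ENNReal.ofReal_ofNat]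
    exact ediam_eball_le
  · refine h.lintegral_enorm_fderiv_mollify_le (φ i) measurableSet_ball
      (isCompact_closedBall z R) hD fun x hx => closedBall_subset_closedBall' ?_
    linarith [mem_ball.1 hx, hφR i]

theorem lintegral_lintegral_enorm_sub_le (h : HasWeakGradientOn D u g)
    {z : EuclideanSpace ℝ (Fin n)} {R : ℝ} (hD : ball z R ⊆ D) :
    ∫⁻ x in ball z R, ∫⁻ y in ball z R, ‖u x - u y‖ₑ
      ≤ ENNReal.ofReal (2 * R) * (2 ^ n * volume (ball z R) * ∫⁻ x in ball z R, ‖g x‖ₑ) := by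
  have hu : AEMeasurable u (volume.restrict (ball z R)) :=
    (h.1.mono_set hD).aestronglyMeasurable.aemeasurable
  have htonelli {r : ℝ} (hr : r ≤ R) :
      ∫⁻ q in ball (z, z) r, ‖u q.1 - u q.2‖ₑ
        = ∫⁻ x in ball z r, ∫⁻ y in ball z r, ‖u x - u y‖ₑ := by
    have hur := hu.mono_measure (Measure.restrict_mono_set volume (ball_subset_ball hr))
    rw [← ball_prod_same, Measure.volume_eq_prod, setLIntegral_prod]
    rw [← Measure.prod_restrict]
    exact (hur.comp_fst.sub hur.comp_snd).enorm
  rw [← htonelli le_rfl]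
  refine setLIntegral_ball_le_of_forall_lt fun r hr => ?_
  obtain ⟨R', hrR', hR'R⟩ := exists_between hr
  have hsub : closedBall z R' ⊆ ball z R := closedBall_subset_ball hR'R
  rw [htonelli hr.le]
  refine (h.lintegral_lintegral_enorm_sub_le_of_lt hrR' (hsub.trans hD)).trans ?_
  gcongr

end HasWeakGradientOn

section Averages

theorem edist_setAverage_le {X : Type*} [MeasurableSpace X] {μ : Measure X} {f : X → ℝ}
    {s : Set X} (hs0 : μ s ≠ 0) (hs : μ s ≠ ⊤) (hf : IntegrableOn f s μ) (c : ℝ) :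
    edist (⨍ x in s, f x ∂μ) c ≤ (μ s)⁻¹ * ∫⁻ x in s, edist (f x) c ∂μ := by
  have : IsFiniteMeasure (μ.restrict s) := ⟨by simpa using hs.lt_top⟩
  have hreal : μ.real s ≠ 0 := ENNReal.toReal_ne_zero.2 ⟨hs0, hs⟩
  have hsub : (⨍ x in s, f x ∂μ) - c = (μ.real s)⁻¹ * ∫ x in s, (f x - c) ∂μ := by
    rw [integral_sub hf (integrable_const c), setAverage_eq, setIntegral_const]
    simp only [smul_eq_mul]
    field_simp
  have hinv : ‖(μ.real s)⁻¹‖ₑ = (μ s)⁻¹ := by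
    rw [enorm_inv hreal, Real.enorm_of_nonneg measureReal_nonneg, Measure.real,
      ENNReal.ofReal_toReal hs]
  simp only [edist_eq_enorm_sub]
  rw [hsub, enorm_mul, hinv]
  gcongr
  exact enorm_integral_le_lintegral_enorm _

/-- The volume of the unit ball of `ℝⁿ`. -/
noncomputable def unitBallVolume (n : ℕ) : ℝ :=
  volume.real (ball (0 : EuclideanSpace ℝ (Fin n)) 1)

theorem unitBallVolume_pos (n : ℕ) : 0 < unitBallVolume n :=
  ENNReal.toReal_pos (measure_ball_pos _ _ one_pos).ne' measure_ball_lt_top.ne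

theorem volume_ball_eq {n : ℕ} (x : EuclideanSpace ℝ (Fin n)) {r : ℝ} (hr : 0 < r) :
    volume (ball x r) = ENNReal.ofReal (r ^ n * unitBallVolume n) := by
  rw [Measure.addHaar_ball_of_pos _ _ hr, finrank_euclideanSpace_fin,
    ENNReal.ofReal_mul (by positivity), unitBallVolume, ofReal_measureReal]

/-- The constant in the comparison of the average of a function over a ball with its average over a
larger ball, see `HasWeakGradientOn.edist_average_le`. -/
noncomputable def poincareConst (n : ℕ) : ℝ := 2 ^ (n + 1) / unitBallVolume n

theorem poincareConst_pos (n : ℕ) : 0 < poincareConst n :=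
  div_pos (by positivity) (unitBallVolume_pos n)

theorem two_mul_div_two_mul_pow_le {n : ℕ} (hn : 2 ≤ n) {ρ : ℝ} (hρ : 0 < ρ) :
    2 * ρ / (2 * ρ) ^ n ≤ 1 / 2 * (ρ / ρ ^ n) := by
  have hpow : (2 : ℝ) ^ 2 ≤ 2 ^ n := pow_le_pow_right₀ one_le_two hn
  rw [mul_pow, mul_div_mul_comm]
  refine mul_le_mul_of_nonneg_right ?_ (by positivity)
  rw [div_le_div_iff₀ (by positivity) two_pos]
  linarith

namespace HasWeakGradientOn

variable {n : ℕ} {D : Set (EuclideanSpace ℝ (Fin n))} {u : EuclideanSpace ℝ (Fin n) → ℝ}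
  {g : EuclideanSpace ℝ (Fin n) → EuclideanSpace ℝ (Fin n)} {z : EuclideanSpace ℝ (Fin n)} {r : ℝ}

theorem integrableOn_ball (h : HasWeakGradientOn D u g) (hD : ball z r ⊆ D)
    (hg : ∫⁻ x in ball z r, ‖g x‖ₑ ≠ ⊤) : IntegrableOn u (ball z r) := by
  rcases le_or_gt r 0 with hr | hr
  · simp [ball_eq_empty.2 hr]
  have hdouble : ∫⁻ x in ball z r, ∫⁻ y in ball z r, ‖u x - u y‖ₑ ≠ ⊤ :=
    ne_top_of_le_ne_top (by finiteness [measure_ball_lt_top (μ := volume) (x := z) (r := r)])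
      (h.lintegral_lintegral_enorm_sub_le hD)
  obtain ⟨x, -, hx⟩ : ∃ x ∈ ball z r, ∫⁻ y in ball z r, ‖u x - u y‖ₑ ≠ ⊤ := by
    by_contra! htop
    rw [setLIntegral_congr_fun measurableSet_ball htop, setLIntegral_const,
      ENNReal.top_mul (measure_ball_pos _ _ hr).ne'] at hdouble
    exact hdouble rfl
  have hmeas : AEStronglyMeasurable u (volume.restrict (ball z r)) :=
    (h.1.mono_set hD).aestronglyMeasurable
  have hsub : IntegrableOn (fun y => u x - u y) (ball z r) :=
    ⟨aestronglyMeasurable_const.sub hmeas, hx.lt_top⟩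
  simpa [Pi.sub_def] using (integrableOn_const measure_ball_lt_top.ne (C := u x)).sub hsub

theorem lintegral_edist_average_le (h : HasWeakGradientOn D u g) (hD : ball z r ⊆ D) :
    ∫⁻ x in ball z r, edist (u x) (⨍ y in ball z r, u y)
      ≤ ENNReal.ofReal (2 ^ (n + 1) * r) * ∫⁻ x in ball z r, ‖g x‖ₑ := by
  rcases le_or_gt r 0 with hr | hr
  · simp [ball_eq_empty.2 hr]
  by_cases hg : ∫⁻ x in ball z r, ‖g x‖ₑ = ⊤
  · rw [hg, ENNReal.mul_top (by simpa using by positivity)]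
    exact le_top
  have hvol0 : volume (ball z r) ≠ 0 := (measure_ball_pos _ _ hr).ne'
  have hvol : volume (ball z r) ≠ ⊤ := measure_ball_lt_top.ne
  calc ∫⁻ x in ball z r, edist (u x) (⨍ y in ball z r, u y)
      ≤ ∫⁻ x in ball z r, (volume (ball z r))⁻¹ * ∫⁻ y in ball z r, ‖u x - u y‖ₑ := by
        refine lintegral_mono fun x => ?_
        rw [edist_comm]
        refine (edist_setAverage_le hvol0 hvol (h.integrableOn_ball hD hg) (u x)).trans_eq ?_
        simp only [edist_comm _ (u x), edist_eq_enorm_sub]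
    _ = (volume (ball z r))⁻¹ * ∫⁻ x in ball z r, ∫⁻ y in ball z r, ‖u x - u y‖ₑ :=
        lintegral_const_mul' _ _ (ENNReal.inv_ne_top.2 hvol0)
    _ ≤ (volume (ball z r))⁻¹ * (ENNReal.ofReal (2 * r) *
          (2 ^ n * volume (ball z r) * ∫⁻ x in ball z r, ‖g x‖ₑ)) := by
        gcongr
        exact h.lintegral_lintegral_enorm_sub_le hD
    _ = (volume (ball z r))⁻¹ * volume (ball z r) *
          (2 ^ n * ENNReal.ofReal (2 * r) * ∫⁻ x in ball z r, ‖g x‖ₑ) := by ring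
    _ = ENNReal.ofReal (2 ^ (n + 1) * r) * ∫⁻ x in ball z r, ‖g x‖ₑ := by
        have hconst : (2 : ℝ≥0∞) ^ n * ENNReal.ofReal (2 * r)
            = ENNReal.ofReal (2 ^ (n + 1) * r) := by
          rw [pow_succ, mul_assoc, ENNReal.ofReal_mul (pow_nonneg two_pos.le n),
            ENNReal.ofReal_pow two_pos.le, ENNReal.ofReal_ofNat]
        rw [ENNReal.inv_mul_cancel hvol0 hvol, one_mul, hconst]

theorem inv_volume_mul_lintegral_edist_average_le (h : HasWeakGradientOn D u g) {ρ : ℝ}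
    (hρ : 0 < ρ) (hD : ball z r ⊆ D) (p : EuclideanSpace ℝ (Fin n)) :
    (volume (ball p ρ))⁻¹ * ∫⁻ x in ball z r, edist (u x) (⨍ y in ball z r, u y)
      ≤ ENNReal.ofReal (poincareConst n * (r / ρ ^ n)) * ∫⁻ x in ball z r, ‖g x‖ₑ := by
  have hω := unitBallVolume_pos n
  calc (volume (ball p ρ))⁻¹ * ∫⁻ x in ball z r, edist (u x) (⨍ y in ball z r, u y)
      ≤ (volume (ball p ρ))⁻¹ *
          (ENNReal.ofReal (2 ^ (n + 1) * r) * ∫⁻ x in ball z r, ‖g x‖ₑ) := by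
        gcongr
        exact h.lintegral_edist_average_le hD
    _ = ENNReal.ofReal (poincareConst n * (r / ρ ^ n)) * ∫⁻ x in ball z r, ‖g x‖ₑ := by
        rw [volume_ball_eq p hρ, ← ENNReal.ofReal_inv_of_pos (by positivity), ← mul_assoc,
          ← ENNReal.ofReal_mul (by positivity), poincareConst]
        congr 2
        field_simp

theorem edist_average_le (h : HasWeakGradientOn D u g) {p : EuclideanSpace ℝ (Fin n)} {ρ : ℝ}
    (hρ : 0 < ρ) (hD : ball z r ⊆ D) (hsub : ball p ρ ⊆ ball z r) :
    edist (⨍ y in ball p ρ, u y) (⨍ y in ball z r, u y)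
      ≤ ENNReal.ofReal (poincareConst n * (r / ρ ^ n)) * ∫⁻ x in ball z r, ‖g x‖ₑ := by
  have hr : 0 < r := pos_of_mem_ball (hsub (mem_ball_self hρ))
  have hP := poincareConst_pos n
  by_cases hg : ∫⁻ x in ball z r, ‖g x‖ₑ = ⊤
  · rw [hg, ENNReal.mul_top (by simpa using by positivity)]
    exact le_top
  calc edist (⨍ y in ball p ρ, u y) (⨍ y in ball z r, u y)
      ≤ (volume (ball p ρ))⁻¹ * ∫⁻ x in ball p ρ, edist (u x) (⨍ y in ball z r, u y) :=
        edist_setAverage_le (measure_ball_pos _ _ hρ).ne' measure_ball_lt_top.ne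
          ((h.integrableOn_ball hD hg).mono_set hsub) _
    _ ≤ (volume (ball p ρ))⁻¹ * ∫⁻ x in ball z r, edist (u x) (⨍ y in ball z r, u y) := by
        gcongr
    _ ≤ ENNReal.ofReal (poincareConst n * (r / ρ ^ n)) * ∫⁻ x in ball z r, ‖g x‖ₑ :=
        h.inv_volume_mul_lintegral_edist_average_le hρ hD p

theorem edist_average_le_of_le_four_mul (h : HasWeakGradientOn D u g)
    {p : EuclideanSpace ℝ (Fin n)} {ρ : ℝ} (hρ : 0 < ρ) (hD : ball z r ⊆ D)
    (hsub : ball p ρ ⊆ ball z r) (hrρ : r ≤ 4 * ρ) :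
    edist (⨍ y in ball p ρ, u y) (⨍ y in ball z r, u y)
      ≤ ENNReal.ofReal (4 * poincareConst n * (ρ / ρ ^ n)) * ∫⁻ x in ball z r, ‖g x‖ₑ := by
  have hP := poincareConst_pos n
  refine (h.edist_average_le hρ hD hsub).trans ?_
  rw [show 4 * poincareConst n * (ρ / ρ ^ n) = poincareConst n * (4 * ρ / ρ ^ n) by ring]
  gcongr

-- Doubling the radius of the small ball multiplies `ρ / ρ ^ n` by at most `1 / 2` when `2 ≤ n`, so
-- that the errors along the chain of doubled balls form a geometric series.
theorem edist_average_le_of_dist_le (hn : 2 ≤ n) (h : HasWeakGradientOn D u g)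
    {p : EuclideanSpace ℝ (Fin n)} {ρ : ℝ} (hρ : 0 < ρ) (hρr : 2 * ρ ≤ r)
    (hpz : 2 * dist p z ≤ r) (hD : ball z r ⊆ D) :
    edist (⨍ y in ball p ρ, u y) (⨍ y in ball z r, u y)
      ≤ ENNReal.ofReal (4 * poincareConst n * (ρ / ρ ^ n)) * ∫⁻ x in ball z r, ‖g x‖ₑ := by
  have hP := poincareConst_pos n
  set G := ∫⁻ x in ball z r, ‖g x‖ₑ
  obtain ⟨m, hm⟩ := pow_unbounded_of_one_lt (r / (4 * ρ)) one_lt_two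
  rw [div_lt_iff₀ (by positivity)] at hm
  induction m generalizing ρ with
  | zero =>
    exact h.edist_average_le_of_le_four_mul hρ hD (ball_subset_ball' (by linarith)) (by linarith)
  | succ m ih =>
    rcases lt_or_ge r (2 * (2 * ρ)) with hlt | hge
    · exact h.edist_average_le_of_le_four_mul hρ hD (ball_subset_ball' (by linarith))
        (by linarith)
    have hball : ball p (2 * ρ) ⊆ ball z r := ball_subset_ball' (by linarith)
    calc edist (⨍ y in ball p ρ, u y) (⨍ y in ball z r, u y)
        ≤ edist (⨍ y in ball p ρ, u y) (⨍ y in ball p (2 * ρ), u y)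
          + edist (⨍ y in ball p (2 * ρ), u y) (⨍ y in ball z r, u y) := edist_triangle _ _ _
      _ ≤ ENNReal.ofReal (poincareConst n * (2 * ρ / ρ ^ n)) * G
          + ENNReal.ofReal (4 * poincareConst n * (2 * ρ / (2 * ρ) ^ n)) * G := by
          gcongr
          · refine (h.edist_average_le hρ (hball.trans hD)
              (ball_subset_ball (by linarith))).trans ?_
            gcongr
            exact lintegral_mono_set hball
          · exact ih (by positivity) hge (by rw [pow_succ] at hm; linarith)
      _ ≤ ENNReal.ofReal (4 * poincareConst n * (ρ / ρ ^ n)) * G := by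
          rw [← add_mul, ← ENNReal.ofReal_add (by positivity) (by positivity)]
          gcongr
          calc poincareConst n * (2 * ρ / ρ ^ n) + 4 * poincareConst n * (2 * ρ / (2 * ρ) ^ n)
              ≤ poincareConst n * (2 * ρ / ρ ^ n)
                + 4 * poincareConst n * (1 / 2 * (ρ / ρ ^ n)) := by
                gcongr
                exact two_mul_div_two_mul_pow_le hn hρ
            _ = 4 * poincareConst n * (ρ / ρ ^ n) := by ring

end HasWeakGradientOn

end Averages

section Chaining

-- Otherwise a missed value `c` would separate `K` into the part covered by the `U y` whose interval
-- lies below `c` and the part covered by those whose interval lies above `c`.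
theorem Icc_subset_iUnion_closedEBall_of_isPreconnected {X ι : Type*} [TopologicalSpace X]
    {K : Set X} (hK : IsPreconnected K) {Z : Finset ι} {U : ι → Set X}
    (hU : ∀ z ∈ Z, IsOpen (U z)) (hcov : K ⊆ ⋃ z ∈ Z, U z) (hne : ∀ z ∈ Z, (K ∩ U z).Nonempty)
    {f : ι → ℝ} {w : ι → ℝ≥0∞}
    (hadj : ∀ z ∈ Z, ∀ z' ∈ Z, (U z ∩ U z').Nonempty → edist (f z) (f z') ≤ w z + w z')
    {z z' : ι} (hz : z ∈ Z) (hz' : z' ∈ Z) :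
    Icc (f z) (f z') ⊆ ⋃ y ∈ Z, closedEBall (f y) (w y) := by
  intro c hc
  by_contra! hmissed
  simp only [mem_iUnion, mem_closedEBall, exists_prop, not_exists, not_and, not_le] at hmissed
  have hside : ∀ y ∈ Z, f y < c ∨ c < f y := by
    intro y hy
    refine lt_or_gt_of_ne fun heq => ?_
    simpa [heq] using hmissed y hy
  set below := ⋃ y ∈ {y ∈ Z | f y < c}, U y
  set above := ⋃ y ∈ {y ∈ Z | c < f y}, U y
  have hcover : K ⊆ below ∪ above := by
    intro x hx
    obtain ⟨y, hy, hxy⟩ := mem_iUnion₂.1 (hcov hx)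
    exact (hside y hy).imp (fun h => mem_biUnion (Finset.mem_filter.2 ⟨hy, h⟩) hxy)
      (fun h => mem_biUnion (Finset.mem_filter.2 ⟨hy, h⟩) hxy)
  have hopen (p : ι → Prop) [DecidablePred p] : IsOpen (⋃ y ∈ {y ∈ Z | p y}, U y) :=
    isOpen_biUnion fun y hy => hU y (Finset.mem_filter.1 hy).1
  have hmeet {p : ι → Prop} [DecidablePred p] {y : ι} (hy : y ∈ Z) (hp : p y) :
      (K ∩ ⋃ y ∈ {y ∈ Z | p y}, U y).Nonempty :=
    (hne y hy).mono <| inter_subset_inter_right K <|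
      subset_biUnion_of_mem (Finset.mem_filter.2 ⟨hy, hp⟩)
  obtain ⟨x, -, hxb, hxa⟩ := hK below above (hopen _) (hopen _) hcover
    (hmeet hz ((hside z hz).resolve_right hc.1.not_gt))
    (hmeet hz' ((hside z' hz').resolve_left hc.2.not_gt))
  obtain ⟨y, hy, hxy⟩ := mem_iUnion₂.1 hxb
  obtain ⟨y', hy', hxy'⟩ := mem_iUnion₂.1 hxa
  obtain ⟨hy, hyc⟩ := Finset.mem_filter.1 hy
  obtain ⟨hy', hcy'⟩ := Finset.mem_filter.1 hy'
  refine (hadj y hy y' hy' ⟨x, hxy, hxy'⟩).not_gt ?_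
  have hsplit : edist (f y) (f y') = edist c (f y) + edist c (f y') := by
    rw [edist_dist, edist_dist, edist_dist, ← ENNReal.ofReal_add dist_nonneg dist_nonneg,
      Real.dist_eq, Real.dist_eq, Real.dist_eq, abs_of_neg (by linarith),
      abs_of_pos (by linarith), abs_of_neg (by linarith)]
    ring_nf
  rw [hsplit]
  exact ENNReal.add_lt_add (hmissed y hy) (hmissed y' hy')

theorem edist_le_two_mul_sum_of_isPreconnected {X ι : Type*} [TopologicalSpace X]
    {K : Set X} (hK : IsPreconnected K) {Z : Finset ι} {U : ι → Set X}
    (hU : ∀ z ∈ Z, IsOpen (U z)) (hcov : K ⊆ ⋃ z ∈ Z, U z) (hne : ∀ z ∈ Z, (K ∩ U z).Nonempty)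
    {f : ι → ℝ} {w : ι → ℝ≥0∞}
    (hadj : ∀ z ∈ Z, ∀ z' ∈ Z, (U z ∩ U z').Nonempty → edist (f z) (f z') ≤ w z + w z')
    {z z' : ι} (hz : z ∈ Z) (hz' : z' ∈ Z) : edist (f z) (f z') ≤ 2 * ∑ y ∈ Z, w y := by
  wlog hle : f z ≤ f z' generalizing z z'
  · rw [edist_comm]
    exact this hz' hz (le_of_not_ge hle)
  calc edist (f z) (f z') = volume (Icc (f z) (f z')) := by
        rw [Real.volume_Icc, edist_comm, edist_dist, Real.dist_eq, abs_of_nonneg (sub_nonneg.2 hle)]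
    _ ≤ ∑ y ∈ Z, volume (closedEBall (f y) (w y)) :=
        (measure_mono (Icc_subset_iUnion_closedEBall_of_isPreconnected hK hU hcov hne hadj hz
          hz')).trans (measure_biUnion_finset_le _ _)
    _ = 2 * ∑ y ∈ Z, w y := by
        rw [Finset.mul_sum]
        exact Finset.sum_congr rfl fun y _ => Real.volume_closedEBall _ _

theorem edist_le_four_mul_sum_of_isPreconnected {X : Type*} [PseudoMetricSpace X]
    {K : Set X} (hK : IsPreconnected K) {r : ℝ} (hr : 0 < r) {Z : Finset X} (hZK : ↑Z ⊆ K)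
    (hcov : K ⊆ ⋃ z ∈ Z, ball z r) {f : X → ℝ} {w : X → ℝ≥0∞}
    (hf : ∀ a ∈ K, ∀ b, dist a b < 2 * r → edist (f a) (f b) ≤ w a)
    {p p' : X} (hp : p ∈ K) (hp' : p' ∈ K) : edist (f p) (f p') ≤ 4 * ∑ z ∈ Z, w z := by
  have hnear {q : X} (hq : q ∈ K) : ∃ z ∈ Z, edist (f z) (f q) ≤ ∑ z ∈ Z, w z := by
    obtain ⟨z, hz, hqz⟩ := mem_iUnion₂.1 (hcov hq)
    have hzq : dist z q < 2 * r := by linarith [mem_ball'.1 hqz]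
    exact ⟨z, hz, (hf z (hZK hz) q hzq).trans (Finset.single_le_sum (fun _ _ => zero_le) hz)⟩
  have hadj : ∀ a ∈ Z, ∀ b ∈ Z, (ball a r ∩ ball b r).Nonempty →
      edist (f a) (f b) ≤ w a + w b := by
    rintro a ha b - ⟨x, hxa, hxb⟩
    have hab : dist a b < 2 * r := by
      linarith [dist_triangle_left a b x, mem_ball.1 hxa, mem_ball.1 hxb]
    exact (hf a (hZK ha) b hab).trans le_self_add
  obtain ⟨z, hz, hpz⟩ := hnear hp
  obtain ⟨z', hz', hpz'⟩ := hnear hp'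
  have hzz' : edist (f z) (f z') ≤ 2 * ∑ z ∈ Z, w z :=
    edist_le_two_mul_sum_of_isPreconnected hK (fun _ _ => isOpen_ball) hcov
      (fun z hz => ⟨z, hZK hz, mem_ball_self hr⟩) hadj hz hz'
  calc edist (f p) (f p') ≤ edist (f p) (f z) + edist (f z) (f z') + edist (f z') (f p') :=
        edist_triangle4 _ _ _ _
    _ ≤ ∑ z ∈ Z, w z + 2 * ∑ z ∈ Z, w z + ∑ z ∈ Z, w z := by
        gcongr
        rwa [edist_comm]
    _ = 4 * ∑ z ∈ Z, w z := by ring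

theorem exists_finset_separated_net {X : Type*} [PseudoMetricSpace X] {K : Set X}
    (hK : TotallyBounded K) {δ : ℝ} (hδ : 0 < δ) :
    ∃ Z : Finset X, ↑Z ⊆ K ∧ (Z : Set X).Pairwise (fun z z' => δ ≤ dist z z') ∧
      K ⊆ ⋃ z ∈ Z, closedBall z δ := by
  lift δ to ℝ≥0 using hδ.le
  have hpack : packingNumber δ K ≠ ⊤ := by
    obtain ⟨N, -, hNfin, hN⟩ := exists_finite_isCover_of_totallyBounded
      (half_pos (NNReal.coe_pos.1 hδ)).ne' hK
    have h := packingNumber_two_mul_le_externalCoveringNumber (δ / 2) K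
    rw [mul_div_cancel₀ δ two_ne_zero] at h
    exact ne_top_of_le_ne_top (encard_ne_top_iff.2 hNfin)
      (h.trans hN.externalCoveringNumber_le_encard)
  have hfin : (maximalSeparatedSet δ K).Finite := by
    rwa [← encard_ne_top_iff, encard_maximalSeparatedSet hpack]
  refine ⟨hfin.toFinset, by simpa using maximalSeparatedSet_subset, ?_, ?_⟩
  · rw [hfin.coe_toFinset]
    refine isSeparated_maximalSeparatedSet.imp fun {z z'} h => ?_
    rw [edist_nndist, ENNReal.coe_lt_coe, ← NNReal.coe_lt_coe, coe_nndist] at h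
    exact h.le
  · simpa using (isCover_maximalSeparatedSet hpack).subset_iUnion_closedBall

section Packing

variable {E : Type*} [NormedAddCommGroup E] [NormedSpace ℝ E] [FiniteDimensional ℝ E]
  [MeasurableSpace E] [BorelSpace E]

theorem card_le_of_pairwise_le_dist {Z : Finset E} {δ ρ : ℝ} (hδ : 0 < δ) (hρ : 0 < ρ)
    (hsep : (Z : Set E).Pairwise fun z z' => δ ≤ dist z z') {y : E} (hy : ∀ z ∈ Z, y ∈ ball z ρ) :
    (Z.card : ℝ≥0∞) ≤ ENNReal.ofReal ((2 * ρ / δ + 1) ^ Module.finrank ℝ E) := by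
  let μ : Measure E := Measure.addHaar
  have hμ0 : μ (ball 0 1) ≠ 0 := (measure_ball_pos _ _ one_pos).ne'
  have hμ : μ (ball 0 1) ≠ ⊤ := measure_ball_lt_top.ne
  have hdisj : (Z : Set E).PairwiseDisjoint fun z => ball z (δ / 2) := fun a ha b hb hab =>
    ball_disjoint_ball (by linarith [hsep ha hb hab])
  have hsub : ⋃ z ∈ Z, ball z (δ / 2) ⊆ ball y (ρ + δ / 2) :=
    iUnion₂_subset fun z hz => ball_subset_ball' (by linarith [mem_ball'.1 (hy z hz)])
  have hvol := measure_mono (μ := μ) hsub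
  rw [measure_biUnion_finset hdisj fun _ _ => measurableSet_ball] at hvol
  simp only [Measure.addHaar_ball_of_pos μ _ (half_pos hδ), Finset.sum_const, nsmul_eq_mul] at hvol
  rw [Measure.addHaar_ball_of_pos μ y (by positivity),
    ← mul_assoc, ENNReal.mul_le_mul_iff_left hμ0 hμ] at hvol
  calc (Z.card : ℝ≥0∞)
      ≤ ENNReal.ofReal ((ρ + δ / 2) ^ Module.finrank ℝ E)
          / ENNReal.ofReal ((δ / 2) ^ Module.finrank ℝ E) :=
        (ENNReal.le_div_iff_mul_le (by simp [hδ]) (by simp)).2 hvol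
    _ = ENNReal.ofReal ((2 * ρ / δ + 1) ^ Module.finrank ℝ E) := by
        rw [← ENNReal.ofReal_div_of_pos (by positivity), ← div_pow]
        congr 2
        field_simp

theorem sum_setLIntegral_ball_le {μ : Measure E} {G : E → ℝ≥0∞} {Z : Finset E} {δ ρ : ℝ}
    (hδ : 0 < δ) (hρ : 0 < ρ) (hsep : (Z : Set E).Pairwise fun z z' => δ ≤ dist z z') {S : Set E}
    (hG : AEMeasurable G (μ.restrict S)) (hS : ∀ z ∈ Z, ball z ρ ⊆ S) :
    ∑ z ∈ Z, ∫⁻ x in ball z ρ, G x ∂μ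
      ≤ ENNReal.ofReal ((2 * ρ / δ + 1) ^ Module.finrank ℝ E) * ∫⁻ x in S, G x ∂μ := by
  classical
  have hind : ∀ z ∈ Z, ∫⁻ x in ball z ρ, G x ∂μ = ∫⁻ x in S, (ball z ρ).indicator G x ∂μ :=
    fun z hz => by
      rw [lintegral_indicator measurableSet_ball, Measure.restrict_restrict measurableSet_ball,
        inter_eq_left.2 (hS z hz)]
  rw [Finset.sum_congr rfl hind,
    ← lintegral_finsetSum' _ fun z _ => hG.indicator measurableSet_ball,
    ← lintegral_const_mul'' _ hG]
  refine lintegral_mono fun x => ?_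
  calc ∑ z ∈ Z, (ball z ρ).indicator G x = ({z ∈ Z | x ∈ ball z ρ}.card : ℝ≥0∞) * G x := by
        simp only [indicator_apply, ← Finset.sum_filter, Finset.sum_const, nsmul_eq_mul]
    _ ≤ ENNReal.ofReal ((2 * ρ / δ + 1) ^ Module.finrank ℝ E) * G x := by
        gcongr
        exact card_le_of_pairwise_le_dist hδ hρ (hsep.mono (Finset.filter_subset _ _))
          fun z hz => (Finset.mem_filter.1 hz).2

end Packing

/-- The constant in the bound for the oscillation of the averages over balls of a fixed radius whose
centers run through a continuum, see `HasWeakGradientOn.edist_average_le_of_isPreconnected`. -/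
noncomputable def chainConst (n : ℕ) : ℝ := 24 * 13 ^ n * poincareConst n

theorem chainConst_pos (n : ℕ) : 0 < chainConst n :=
  mul_pos (by positivity) (poincareConst_pos n)

namespace HasWeakGradientOn

variable {n : ℕ} {D : Set (EuclideanSpace ℝ (Fin n))} {u : EuclideanSpace ℝ (Fin n) → ℝ}
  {g : EuclideanSpace ℝ (Fin n) → EuclideanSpace ℝ (Fin n)}

theorem edist_average_le_of_dist_lt (h : HasWeakGradientOn D u g) {r : ℝ} (hr : 0 < r)
    {a b : EuclideanSpace ℝ (Fin n)} (ha : ball a (3 * r) ⊆ D) (hab : dist a b < 2 * r) :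
    edist (⨍ y in ball a r, u y) (⨍ y in ball b r, u y)
      ≤ ENNReal.ofReal (6 * poincareConst n * (r / r ^ n)) * ∫⁻ x in ball a (3 * r), ‖g x‖ₑ := by
  have hP := poincareConst_pos n
  have henlarge {p : EuclideanSpace ℝ (Fin n)} (hp : ball p r ⊆ ball a (3 * r)) :
      edist (⨍ y in ball p r, u y) (⨍ y in ball a (3 * r), u y)
        ≤ ENNReal.ofReal (3 * poincareConst n * (r / r ^ n)) * ∫⁻ x in ball a (3 * r), ‖g x‖ₑ := by
    refine (h.edist_average_le hr ha hp).trans_eq ?_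
    congr 2
    ring
  have hself := henlarge (p := a) (ball_subset_ball (by linarith))
  have hother := henlarge (p := b) (ball_subset_ball' (by linarith [dist_comm a b]))
  refine (edist_triangle_right _ _ _).trans ((add_le_add hself hother).trans_eq ?_)
  rw [← add_mul, ← ENNReal.ofReal_add (by positivity) (by positivity)]
  congr 2
  ring

theorem edist_average_le_of_isPreconnected (h : HasWeakGradientOn D u g)
    {K S : Set (EuclideanSpace ℝ (Fin n))} (hKc : IsCompact K) (hKp : IsPreconnected K)
    {r : ℝ} (hr : 0 < r) (hSD : S ⊆ D) (hS : ∀ y ∈ K, ball y (3 * r) ⊆ S)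
    {p p' : EuclideanSpace ℝ (Fin n)} (hp : p ∈ K) (hp' : p' ∈ K) :
    edist (⨍ y in ball p r, u y) (⨍ y in ball p' r, u y)
      ≤ ENNReal.ofReal (chainConst n * (r / r ^ n)) * ∫⁻ x in S, ‖g x‖ₑ := by
  have hP := poincareConst_pos n
  obtain ⟨Z, hZK, hsep, hcov⟩ := exists_finset_separated_net hKc.totallyBounded (half_pos hr)
  set w : EuclideanSpace ℝ (Fin n) → ℝ≥0∞ := fun p =>
    ENNReal.ofReal (6 * poincareConst n * (r / r ^ n)) * ∫⁻ x in ball p (3 * r), ‖g x‖ₑ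
  have hsum : ∑ z ∈ Z, w z ≤ ENNReal.ofReal (6 * poincareConst n * (r / r ^ n)) *
      (ENNReal.ofReal (13 ^ n) * ∫⁻ x in S, ‖g x‖ₑ) := by
    rw [← Finset.mul_sum]
    gcongr
    refine (sum_setLIntegral_ball_le (half_pos hr) (by positivity) hsep
      (h.2.1.mono_set hSD).aestronglyMeasurable.enorm fun z hz => hS z (hZK hz)).trans_eq ?_
    rw [finrank_euclideanSpace_fin, show 2 * (3 * r) / (r / 2) + 1 = 13 by field_simp; norm_num]
  calc edist (⨍ y in ball p r, u y) (⨍ y in ball p' r, u y) ≤ 4 * ∑ z ∈ Z, w z :=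
        edist_le_four_mul_sum_of_isPreconnected (f := fun p => ⨍ y in ball p r, u y) hKp hr hZK
          (hcov.trans (iUnion₂_mono fun z _ => closedBall_subset_ball (half_lt_self hr)))
          (fun a ha b hab => h.edist_average_le_of_dist_lt hr ((hS a ha).trans hSD) hab) hp hp'
    _ ≤ ENNReal.ofReal 4 * (ENNReal.ofReal (6 * poincareConst n * (r / r ^ n)) *
          (ENNReal.ofReal (13 ^ n) * ∫⁻ x in S, ‖g x‖ₑ)) := by
        rw [ENNReal.ofReal_ofNat]
        gcongr
    _ = ENNReal.ofReal (chainConst n * (r / r ^ n)) * ∫⁻ x in S, ‖g x‖ₑ := by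
        simp only [← mul_assoc]
        rw [← ENNReal.ofReal_mul (by positivity), ← ENNReal.ofReal_mul (by positivity), chainConst]
        congr 2
        ring

end HasWeakGradientOn

end Chaining

section DyadicPotential

variable {X : Type*} [PseudoMetricSpace X] [MeasurableSpace X]

/-- The contribution `2^{dj} ∫_{B(x, A 2⁻ʲ)} f dμ` of the scale `A 2⁻ʲ` to the dyadic potential. -/
noncomputable def dyadicTerm (d A : ℝ) (f : X → ℝ≥0∞) (μ : Measure X) (x : X) (j : ℕ) : ℝ≥0∞ :=
  ENNReal.ofReal (2 ^ d) ^ j * ∫⁻ y in ball x (A * (1 / 2) ^ j), f y ∂μ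

/-- The dyadic potential `∑ⱼ 2^{dj} ∫_{B(x, A 2⁻ʲ)} f dμ`, a discrete version of the Riesz-type
potential `∫_{B(x, A)} f(y) |x - y|^{-d} dμ(y)`. -/
noncomputable def dyadicPotential (d A : ℝ) (f : X → ℝ≥0∞) (μ : Measure X) (x : X) : ℝ≥0∞ :=
  ∑' j, dyadicTerm d A f μ x j

theorem dyadicPotential_mono_exponent {d d' : ℝ} (hd : d ≤ d') (A : ℝ) (f : X → ℝ≥0∞)
    (μ : Measure X) (x : X) : dyadicPotential d A f μ x ≤ dyadicPotential d' A f μ x := by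
  unfold dyadicPotential dyadicTerm
  gcongr
  exact one_le_two

theorem half_rpow_div_pow (s : ℝ) (n : ℕ) :
    (1 / 2 : ℝ) ^ s / ((1 / 2) ^ s) ^ n = 2 ^ (s * ((n : ℝ) - 1)) := by
  rw [one_div, Real.inv_rpow two_pos.le, ← Real.rpow_neg two_pos.le, ← Real.rpow_natCast,
    ← Real.rpow_mul two_pos.le, ← Real.rpow_sub two_pos]
  congr 1
  ring

theorem mul_pow_div_mul_pow_pow (c σ : ℝ) (j n : ℕ) :
    c * σ ^ j / (c * σ ^ j) ^ n = c / c ^ n * (σ / σ ^ n) ^ j := by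
  rw [mul_pow, ← pow_mul, mul_comm j n, pow_mul, mul_div_mul_comm, ← div_pow]

theorem ofReal_mul_setLIntegral_le_dyadicTerm [OpensMeasurableSpace X] {a c A s : ℝ} (ha : 0 ≤ a)
    (hc : 0 ≤ c) (n : ℕ) {j : ℕ} (f : X → ℝ≥0∞) (μ : Measure X) {S D : Set X} {x : X}
    (hS : S ⊆ ball x (A * (1 / 2) ^ j) ∩ D) :
    ENNReal.ofReal (a * (c * ((1 / 2) ^ s) ^ j / (c * ((1 / 2) ^ s) ^ j) ^ n)) * ∫⁻ y in S, f y ∂μ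
      ≤ ENNReal.ofReal (a * (c / c ^ n)) *
        dyadicTerm (s * ((n : ℝ) - 1)) A f (μ.restrict D) x j := by
  have hint : ∫⁻ y in S, f y ∂μ ≤ ∫⁻ y in ball x (A * (1 / 2) ^ j), f y ∂μ.restrict D := by
    rw [Measure.restrict_restrict measurableSet_ball]
    exact lintegral_mono_set hS
  rw [mul_pow_div_mul_pow_pow, half_rpow_div_pow, ← mul_assoc a, ENNReal.ofReal_mul (by positivity),
    ENNReal.ofReal_pow (by positivity), dyadicTerm, mul_assoc]
  exact mul_le_mul_right (mul_le_mul_right hint _) _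

end DyadicPotential

section LebesguePoints

theorem tendsto_nhdsGT_zero_of_forall_dyadic_le {A : ℝ} (hA : 0 < A) {F : ℝ → ℝ≥0∞}
    {ε : ℕ → ℝ≥0∞} (hε : Tendsto ε atTop (𝓝 0))
    (hF : ∀ᶠ j in atTop, ∀ r ∈ Icc (A * (1 / 2) ^ (j + 1)) (A * (1 / 2) ^ j), F r ≤ ε j) :
    Tendsto F (𝓝[>] 0) (𝓝 0) := by
  rw [ENNReal.tendsto_nhds_zero] at hε ⊢
  intro δ hδ
  obtain ⟨J, hJ⟩ := eventually_atTop.1 (hF.and (hε δ hδ))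
  filter_upwards [Ioo_mem_nhdsGT (by positivity : 0 < A * (1 / 2) ^ J)] with r hr
  have hrA : r / A < (1 / 2) ^ J := (div_lt_iff₀' hA).2 hr.2
  obtain ⟨k, hlt, hle⟩ := exists_nat_pow_near_of_lt_one (div_pos hr.1 hA)
    (hrA.le.trans (pow_le_one₀ one_half_pos.le one_half_lt_one.le)) one_half_pos one_half_lt_one
  have hJk : J ≤ k := Nat.lt_succ_iff.1 <|
    (pow_lt_pow_iff_right_of_lt_one₀ one_half_pos one_half_lt_one).1 (hlt.trans hrA)
  obtain ⟨hFk, hεk⟩ := hJ k hJk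
  exact (hFk r ⟨((lt_div_iff₀' hA).1 hlt).le, (div_le_iff₀' hA).1 hle⟩).trans hεk

theorem eventually_ball_dyadic_subset {X : Type*} [PseudoMetricSpace X] {D : Set X} (hD : IsOpen D)
    {x : X} (hx : x ∈ D) (A : ℝ) : ∀ᶠ j : ℕ in atTop, ball x (A * (1 / 2) ^ j) ⊆ D := by
  have hlim : Tendsto (fun j : ℕ => A * (1 / 2) ^ j) atTop (𝓝 0) := by
    simpa using (tendsto_pow_atTop_nhds_zero_of_lt_one one_half_pos.le one_half_lt_one).const_mul A
  exact (hlim.eventually (eventually_closedBall_subset (hD.mem_nhds hx))).mono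
    fun j hj => ball_subset_closedBall.trans hj

namespace HasWeakGradientOn

variable {n : ℕ} {D : Set (EuclideanSpace ℝ (Fin n))} {u : EuclideanSpace ℝ (Fin n) → ℝ}
  {g : EuclideanSpace ℝ (Fin n) → EuclideanSpace ℝ (Fin n)} {x : EuclideanSpace ℝ (Fin n)}
  {A : ℝ}

theorem enorm_average_abs_sub_le (h : HasWeakGradientOn D u g) {ρ r R : ℝ} (hρ : 0 < ρ)
    (hρr : ρ ≤ r) (hrR : r ≤ R) (hD : ball x R ⊆ D) (c : ℝ) :
    ‖⨍ y in ball x r, |u y - c|‖ₑ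
      ≤ ENNReal.ofReal (poincareConst n * (R / ρ ^ n)) * (∫⁻ y in ball x R, ‖g y‖ₑ)
        + ENNReal.ofReal ((R / ρ) ^ n) * edist (⨍ y in ball x R, u y) c := by
  have hω := unitBallVolume_pos n
  have hP := poincareConst_pos n
  have hr : 0 < r := hρ.trans_le hρr
  have hR : 0 < R := hr.trans_le hrR
  by_cases hg : ∫⁻ y in ball x R, ‖g y‖ₑ = ⊤
  · rw [hg, ENNReal.mul_top (by simpa using by positivity), top_add]
    exact le_top
  have hint : IntegrableOn (fun y => |u y - c|) (ball x r) :=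
    (((h.integrableOn_ball hD hg).mono_set (ball_subset_ball hrR)).sub
      (integrableOn_const measure_ball_lt_top.ne)).abs
  set b := ⨍ y in ball x R, u y
  have hratio : (volume (ball x ρ))⁻¹ * volume (ball x R) = ENNReal.ofReal ((R / ρ) ^ n) := by
    rw [volume_ball_eq x hρ, volume_ball_eq x hR, ← ENNReal.ofReal_inv_of_pos (by positivity),
      ← ENNReal.ofReal_mul (by positivity), div_pow]
    congr 1
    field_simp
  calc ‖⨍ y in ball x r, |u y - c|‖ₑ
      ≤ (volume (ball x r))⁻¹ * ∫⁻ y in ball x r, edist (u y) c := by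
        rw [← edist_zero_right]
        refine (edist_setAverage_le (measure_ball_pos _ _ hr).ne' measure_ball_lt_top.ne hint
          0).trans_eq ?_
        simp only [edist_zero_right, Real.enorm_abs, ← edist_eq_enorm_sub]
    _ ≤ (volume (ball x ρ))⁻¹ * ∫⁻ y in ball x R, (edist (u y) b + edist b c) := by
        gcongr
        exact edist_triangle _ _ _
    _ = (volume (ball x ρ))⁻¹ * (∫⁻ y in ball x R, edist (u y) b)
          + ENNReal.ofReal ((R / ρ) ^ n) * edist b c := by
        rw [lintegral_add_right _ measurable_const, setLIntegral_const, mul_add,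
          mul_comm (edist b c), ← mul_assoc, hratio]
    _ ≤ _ := by
        exact add_le_add_left (h.inv_volume_mul_lintegral_edist_average_le hρ hD x) _

theorem ofReal_mul_lintegral_ball_le_dyadicTerm (hA : 0 < A) {j : ℕ}
    (hD : ball x (A * (1 / 2) ^ j) ⊆ D) :
    ENNReal.ofReal (poincareConst n * (A * (1 / 2) ^ j / (A * (1 / 2) ^ (j + 1)) ^ n)) *
        ∫⁻ y in ball x (A * (1 / 2) ^ j), ‖g y‖ₑ
      ≤ ENNReal.ofReal (2 * poincareConst n * (A / 2 / (A / 2) ^ n)) *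
        dyadicTerm ((n : ℝ) - 1) A (fun y => ‖g y‖ₑ) (volume.restrict D) x j := by
  have hP := poincareConst_pos n
  have hscale : A * (1 / 2) ^ (j + 1) = A / 2 * ((1 / 2) ^ (1 : ℝ)) ^ j := by
    rw [Real.rpow_one]
    ring
  have hratio : poincareConst n * (A * (1 / 2) ^ j / (A * (1 / 2) ^ (j + 1)) ^ n)
      = 2 * poincareConst n * (A * (1 / 2) ^ (j + 1) / (A * (1 / 2) ^ (j + 1)) ^ n) := by ring
  rw [hratio, hscale]
  have hterm := ofReal_mul_setLIntegral_le_dyadicTerm (a := 2 * poincareConst n) (c := A / 2)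
    (s := 1) (by positivity) (by positivity) n (fun y => ‖g y‖ₑ) volume
    (subset_inter subset_rfl hD)
  rwa [one_mul] at hterm

theorem exists_tendsto_average (h : HasWeakGradientOn D u g) (hDo : IsOpen D) (hx : x ∈ D)
    (hA : 0 < A)
    (hfin : dyadicPotential ((n : ℝ) - 1) A (fun y => ‖g y‖ₑ) (volume.restrict D) x ≠ ⊤) :
    ∃ c : ℝ, Tendsto (fun j : ℕ => ⨍ y in ball x (A * (1 / 2) ^ j), u y) atTop (𝓝 c) := by
  obtain ⟨J, hJ⟩ := eventually_atTop.1 (eventually_ball_dyadic_subset hDo hx A)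
  set C := ENNReal.ofReal (2 * poincareConst n * (A / 2 / (A / 2) ^ n))
  set e := dyadicTerm ((n : ℝ) - 1) A (fun y => ‖g y‖ₑ) (volume.restrict D) x
  set b : ℕ → ℝ := fun j => ⨍ y in ball x (A * (1 / 2) ^ j), u y
  have hstep (j : ℕ) : edist (b (j + J)) (b (j.succ + J)) ≤ C * e (j + J) := by
    rw [edist_comm, Nat.succ_add]
    have hD := hJ (j + J) (Nat.le_add_left J j)
    refine (h.edist_average_le (by positivity) hD (ball_subset_ball ?_)).trans
      (ofReal_mul_lintegral_ball_le_dyadicTerm hA hD)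
    gcongr A * ?_
    exact pow_le_pow_of_le_one one_half_pos.le one_half_lt_one.le (Nat.le_succ _)
  have hsum : ∑' j, C * e (j + J) ≠ ⊤ := by
    rw [ENNReal.tsum_mul_left]
    exact ENNReal.mul_ne_top ENNReal.ofReal_ne_top <| ne_top_of_le_ne_top hfin <|
      ENNReal.tsum_comp_le_tsum_of_injective (add_left_injective J) e
  obtain ⟨c, hc⟩ := cauchySeq_tendsto_of_complete
    (cauchySeq_of_edist_le_of_tsum_ne_top (fun j => C * e (j + J)) hstep hsum)
  exact ⟨c, (tendsto_add_atTop_iff_nat J).1 hc⟩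

theorem tendsto_average_abs_sub (h : HasWeakGradientOn D u g) (hDo : IsOpen D) (hx : x ∈ D)
    (hA : 0 < A)
    (hfin : dyadicPotential ((n : ℝ) - 1) A (fun y => ‖g y‖ₑ) (volume.restrict D) x ≠ ⊤)
    {c : ℝ} (hc : Tendsto (fun j : ℕ => ⨍ y in ball x (A * (1 / 2) ^ j), u y) atTop (𝓝 c)) :
    Tendsto (fun r : ℝ => ⨍ y in ball x r, |u y - c|) (𝓝[>] 0) (𝓝 0) := by
  set C := ENNReal.ofReal (2 * poincareConst n * (A / 2 / (A / 2) ^ n))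
  set e := dyadicTerm ((n : ℝ) - 1) A (fun y => ‖g y‖ₑ) (volume.restrict D) x
  set b : ℕ → ℝ := fun j => ⨍ y in ball x (A * (1 / 2) ^ j), u y
  have hbound :
      Tendsto (fun j => C * e j + ENNReal.ofReal (2 ^ n) * edist (b j) c) atTop (𝓝 0) := by
    have he := ENNReal.Tendsto.const_mul (a := C) (ENNReal.tendsto_atTop_zero_of_tsum_ne_top hfin)
      (Or.inr ENNReal.ofReal_ne_top)
    have hb := ENNReal.Tendsto.const_mul (a := ENNReal.ofReal (2 ^ n))
      (tendsto_iff_edist_tendsto_0.1 hc) (Or.inr ENNReal.ofReal_ne_top)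
    simpa only [mul_zero, add_zero] using he.add hb
  rw [tendsto_zero_iff_enorm_tendsto_zero]
  refine tendsto_nhdsGT_zero_of_forall_dyadic_le hA hbound ?_
  filter_upwards [eventually_ball_dyadic_subset hDo hx A] with j hD r hr
  have hratio : A * (1 / 2) ^ j / (A * (1 / 2) ^ (j + 1)) = 2 := by
    rw [pow_succ]
    field_simp
  refine (h.enorm_average_abs_sub_le (by positivity) hr.1 hr.2 hD c).trans ?_
  rw [hratio]
  exact add_le_add_left (ofReal_mul_lintegral_ball_le_dyadicTerm hA hD) _

end HasWeakGradientOn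

end LebesguePoints

section ContinuumChains

/-- A chain from `x₀` to `x` in `D`: consecutive points are joined by continua, the `j`-th of which
has distance at least `3 c 2^{-sj}` to the complement of `D` and lies, together with its
neighbourhood of that size, in `B(x, A 2⁻ʲ)`. It stands for a John curve cut at the arc lengths
`2⁻ʲ`. -/
structure ContinuumChain {X : Type*} [PseudoMetricSpace X] (D : Set X) (x₀ x : X) (s c A : ℝ) where
  point : ℕ → X
  link : ℕ → Set X
  point_zero : point 0 = x₀
  point_mem_link : ∀ j, point j ∈ link j
  point_succ_mem_link : ∀ j, point (j + 1) ∈ link j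
  isCompact_link : ∀ j, IsCompact (link j)
  isPreconnected_link : ∀ j, IsPreconnected (link j)
  ball_subset : ∀ j, ∀ y ∈ link j,
    ball y (3 * (c * ((1 / 2) ^ s) ^ j)) ⊆ ball x (A * (1 / 2) ^ j) ∩ D
  two_mul_dist_point_le : ∀ j, 2 * dist (point j) x ≤ A * (1 / 2) ^ j

/-- The constant in the bound for the oscillation of averages along a `ContinuumChain`. -/
noncomputable def continuumChainConst (n : ℕ) (s c : ℝ) : ℝ :=
  (chainConst n + poincareConst n / ((1 / 2) ^ s) ^ n + 4 * poincareConst n) * (c / c ^ n)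

theorem half_rpow_le_half {s : ℝ} (hs : 1 ≤ s) : (1 / 2 : ℝ) ^ s ≤ 1 / 2 := by
  simpa using Real.rpow_le_rpow_of_exponent_ge one_half_pos one_half_lt_one.le hs

namespace ContinuumChain

variable {n : ℕ} {D : Set (EuclideanSpace ℝ (Fin n))} {u : EuclideanSpace ℝ (Fin n) → ℝ}
  {g : EuclideanSpace ℝ (Fin n) → EuclideanSpace ℝ (Fin n)} {x₀ x : EuclideanSpace ℝ (Fin n)}
  {s c A : ℝ}

theorem edist_average_succ_le (γ : ContinuumChain D x₀ x s c A) (h : HasWeakGradientOn D u g)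
    (hs : 1 ≤ s) (hc : 0 < c) (j : ℕ) :
    edist (⨍ y in ball (γ.point j) (c * ((1 / 2) ^ s) ^ j), u y)
        (⨍ y in ball (γ.point (j + 1)) (c * ((1 / 2) ^ s) ^ (j + 1)), u y)
      ≤ ENNReal.ofReal (continuumChainConst n s c) *
        dyadicTerm (s * ((n : ℝ) - 1)) A (fun y => ‖g y‖ₑ) (volume.restrict D) x j := by
  have hP := poincareConst_pos n
  have hC := chainConst_pos n
  set S := ball x (A * (1 / 2) ^ j) ∩ D
  set σ : ℝ := (1 / 2) ^ s
  have hσ0 : 0 < σ := by positivity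
  set r := c * σ ^ j with hr
  have hr0 : 0 < r := by positivity
  have hrσ : c * σ ^ (j + 1) = r * σ := by rw [hr, pow_succ, mul_assoc]
  have hrσr : r * σ ≤ r :=
    mul_le_of_le_one_right hr0.le ((half_rpow_le_half hs).trans (by norm_num))
  have hball : ball (γ.point (j + 1)) r ⊆ S :=
    (ball_subset_ball (by linarith)).trans (γ.ball_subset j _ (γ.point_succ_mem_link j))
  have hmove := h.edist_average_le_of_isPreconnected (γ.isCompact_link j) (γ.isPreconnected_link j)
    hr0 inter_subset_right (γ.ball_subset j) (γ.point_mem_link j) (γ.point_succ_mem_link j)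
  have hshrink := h.edist_average_le (mul_pos hr0 hσ0) (hball.trans inter_subset_right)
    (ball_subset_ball hrσr)
  calc edist (⨍ y in ball (γ.point j) r, u y) (⨍ y in ball (γ.point (j + 1)) (c * σ ^ (j + 1)), u y)
      ≤ ENNReal.ofReal (chainConst n * (r / r ^ n)) * (∫⁻ y in S, ‖g y‖ₑ)
        + ENNReal.ofReal (poincareConst n * (r / (r * σ) ^ n)) * ∫⁻ y in S, ‖g y‖ₑ := by
        rw [hrσ]
        refine (edist_triangle_right _ _ _).trans (add_le_add hmove (hshrink.trans ?_))
        exact mul_le_mul_right (lintegral_mono_set hball) _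
    _ = ENNReal.ofReal ((chainConst n + poincareConst n / σ ^ n) * (r / r ^ n)) *
          ∫⁻ y in S, ‖g y‖ₑ := by
        rw [← add_mul, ← ENNReal.ofReal_add (by positivity) (by positivity), mul_pow r]
        congr 2
        field_simp
    _ ≤ ENNReal.ofReal ((chainConst n + poincareConst n / σ ^ n) * (c / c ^ n)) *
          dyadicTerm (s * ((n : ℝ) - 1)) A (fun y => ‖g y‖ₑ) (volume.restrict D) x j :=
        ofReal_mul_setLIntegral_le_dyadicTerm (by positivity) hc.le n _ _ subset_rfl
    _ ≤ _ := by
        gcongr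
        rw [continuumChainConst]
        gcongr ?_ * _
        exact le_add_of_nonneg_right (by positivity)

theorem edist_average_point_le (γ : ContinuumChain D x₀ x s c A) (h : HasWeakGradientOn D u g)
    (hn : 2 ≤ n) (hs : 1 ≤ s) (hc : 0 < c) (hcA : 2 * c ≤ A) {j : ℕ}
    (hD : ball x (A * (1 / 2) ^ j) ⊆ D) :
    edist (⨍ y in ball (γ.point j) (c * ((1 / 2) ^ s) ^ j), u y)
        (⨍ y in ball x (A * (1 / 2) ^ j), u y)
      ≤ ENNReal.ofReal (continuumChainConst n s c) *
        dyadicTerm (s * ((n : ℝ) - 1)) A (fun y => ‖g y‖ₑ) (volume.restrict D) x j := by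
  have hP := poincareConst_pos n
  have hC := chainConst_pos n
  have hradius : 2 * (c * ((1 / 2) ^ s) ^ j) ≤ A * (1 / 2) ^ j := by
    have hA : 0 ≤ A := by linarith
    rw [← mul_assoc]
    gcongr
    exact half_rpow_le_half hs
  calc edist (⨍ y in ball (γ.point j) (c * ((1 / 2) ^ s) ^ j), u y)
        (⨍ y in ball x (A * (1 / 2) ^ j), u y)
      ≤ _ := h.edist_average_le_of_dist_le hn (by positivity) hradius (γ.two_mul_dist_point_le j) hD
    _ ≤ ENNReal.ofReal (4 * poincareConst n * (c / c ^ n)) *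
          dyadicTerm (s * ((n : ℝ) - 1)) A (fun y => ‖g y‖ₑ) (volume.restrict D) x j :=
        ofReal_mul_setLIntegral_le_dyadicTerm (by positivity) hc.le n _ _
          (subset_inter subset_rfl hD)
    _ ≤ _ := by
        gcongr
        rw [continuumChainConst]
        gcongr
        exact le_add_of_nonneg_left (by positivity)

theorem edist_average_le (γ : ContinuumChain D x₀ x s c A) (h : HasWeakGradientOn D u g)
    (hn : 2 ≤ n) (hs : 1 ≤ s) (hc : 0 < c) (hcA : 2 * c ≤ A) {J : ℕ}
    (hD : ball x (A * (1 / 2) ^ J) ⊆ D) :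
    edist (⨍ y in ball x₀ c, u y) (⨍ y in ball x (A * (1 / 2) ^ J), u y)
      ≤ ENNReal.ofReal (continuumChainConst n s c) *
        dyadicPotential (s * ((n : ℝ) - 1)) A (fun y => ‖g y‖ₑ) (volume.restrict D) x := by
  set C := ENNReal.ofReal (continuumChainConst n s c)
  set e := dyadicTerm (s * ((n : ℝ) - 1)) A (fun y => ‖g y‖ₑ) (volume.restrict D) x
  set f : ℕ → ℝ := fun j => ⨍ y in ball (γ.point j) (c * ((1 / 2) ^ s) ^ j), u y
  have hf0 : ⨍ y in ball x₀ c, u y = f 0 := by simp only [f, γ.point_zero, pow_zero, mul_one]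
  rw [hf0]
  calc edist (f 0) (⨍ y in ball x (A * (1 / 2) ^ J), u y)
      ≤ edist (f 0) (f J) + edist (f J) (⨍ y in ball x (A * (1 / 2) ^ J), u y) :=
        edist_triangle _ _ _
    _ ≤ ∑ j ∈ Finset.range J, C * e j + C * e J := by
        refine add_le_add ((edist_le_range_sum_edist f J).trans ?_)
          (γ.edist_average_point_le h hn hs hc hcA hD)
        exact Finset.sum_le_sum fun j _ => γ.edist_average_succ_le h hs hc j
    _ = C * ∑ j ∈ Finset.range (J + 1), e j := by rw [← Finset.sum_range_succ, Finset.mul_sum]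
    _ ≤ C * ∑' j, e j := by
        gcongr
        exact ENNReal.sum_le_tsum _

theorem exists_tendsto_average_abs_sub (γ : ContinuumChain D x₀ x s c A)
    (h : HasWeakGradientOn D u g) (hDo : IsOpen D) (hx : x ∈ D) (hn : 2 ≤ n) (hs : 1 ≤ s)
    (hc : 0 < c) (hcA : 2 * c ≤ A)
    (hfin : dyadicPotential (s * ((n : ℝ) - 1)) A (fun y => ‖g y‖ₑ) (volume.restrict D) x ≠ ⊤) :
    ∃ b : ℝ, Tendsto (fun r : ℝ => ⨍ y in ball x r, |u y - b|) (𝓝[>] 0) (𝓝 0) ∧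
      edist b (⨍ y in ball x₀ c, u y) ≤ ENNReal.ofReal (continuumChainConst n s c) *
        dyadicPotential (s * ((n : ℝ) - 1)) A (fun y => ‖g y‖ₑ) (volume.restrict D) x := by
  have hA : 0 < A := by linarith
  have hn1 : (1 : ℝ) ≤ n := by exact_mod_cast one_le_two.trans hn
  have hfin' := ne_top_of_le_ne_top hfin <| dyadicPotential_mono_exponent
    (le_mul_of_one_le_left (sub_nonneg.2 hn1) hs) A (fun y => ‖g y‖ₑ) (volume.restrict D) x
  obtain ⟨b, hb⟩ := h.exists_tendsto_average hDo hx hA hfin'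
  refine ⟨b, h.tendsto_average_abs_sub hDo hx hA hfin' hb, ?_⟩
  rw [edist_comm]
  refine le_of_tendsto (tendsto_const_nhds.edist hb) ?_
  filter_upwards [eventually_ball_dyadic_subset hDo hx A] with J hD
  exact γ.edist_average_le h hn hs hc hcA hD

end ContinuumChain

end ContinuumChains

section JohnDomains

theorem ball_infDist_frontier_subset {E : Type*} [NormedAddCommGroup E] [NormedSpace ℝ E]
    [FiniteDimensional ℝ E] {D : Set E} {x : E} (hx : x ∈ D) :
    ball x (infDist x (frontier D)) ⊆ D := by
  rcases eq_or_ne D univ with rfl | hD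
  · exact subset_univ _
  obtain ⟨y, hy, hxy⟩ := exists_mem_frontier_infDist_compl_eq_dist hx hD
  refine (ball_subset_ball ?_).trans (ball_infDist_compl_subset (x := x))
  rw [hxy]
  exact infDist_le_dist_of_mem hy

theorem infDist_frontier_pos {E : Type*} [NormedAddCommGroup E] [NormedSpace ℝ E] [Nontrivial E]
    {D : Set E} (hDo : IsOpen D) (hDb : Bornology.IsBounded D) {x : E} (hx : x ∈ D) :
    0 < infDist x (frontier D) := by
  have hne : (frontier D).Nonempty := by
    rw [nonempty_frontier_iff]
    refine ⟨⟨x, hx⟩, ?_⟩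
    rintro rfl
    exact NormedSpace.unbounded_univ ℝ E hDb
  rw [← isClosed_frontier.notMem_iff_infDist_pos hne, hDo.frontier_eq]
  exact fun h => h.2 hx

theorem edist_le_of_hasUnitSpeedOn {X : Type*} [PseudoEMetricSpace X] {γ : ℝ → X} {S : Set ℝ}
    (h : HasUnitSpeedOn γ S) {a b : ℝ} (ha : a ∈ S) (hb : b ∈ S) :
    edist (γ a) (γ b) ≤ edist a b := by
  wlog hab : a ≤ b generalizing a b
  · rw [edist_comm, edist_comm a]
    exact this hb ha (le_of_not_ge hab)
  have hvar : eVariationOn γ (S ∩ Icc a b) = ENNReal.ofReal (b - a) := by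
    simpa using h ha hb
  rw [edist_comm a, edist_dist b, Real.dist_eq, abs_of_nonneg (sub_nonneg.2 hab), ← hvar]
  exact eVariationOn.edist_le γ ⟨ha, left_mem_Icc.2 hab⟩ ⟨hb, right_mem_Icc.2 hab⟩

theorem lipschitzOnWith_one_of_hasUnitSpeedOn {X : Type*} [PseudoEMetricSpace X] {γ : ℝ → X}
    {S : Set ℝ} (h : HasUnitSpeedOn γ S) : LipschitzOnWith 1 γ S := fun a ha b hb => by
  simpa using edist_le_of_hasUnitSpeedOn h ha hb

theorem three_mul_le_of_rpow_le {α β s ℓ c : ℝ} (hα : 0 < α) (hβ : 0 < β) (hs : 0 ≤ s)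
    (hc : 0 ≤ c) (hcβ : 3 * c ≤ α / β * (β / 2) ^ s) {φ : ℝ → ℝ}
    (hφ : ∀ t ∈ Icc 0 ℓ, t ^ s ≤ β / α * φ t) (hcℓ : 3 * c ≤ φ ℓ) {j : ℕ} {t : ℝ}
    (ht : t ∈ Icc (min (β * (1 / 2) ^ (j + 1)) ℓ) (min (β * (1 / 2) ^ j) ℓ)) :
    3 * (c * ((1 / 2) ^ s) ^ j) ≤ φ t := by
  obtain ⟨htlow, htℓ⟩ : min (β * (1 / 2) ^ (j + 1)) ℓ ≤ t ∧ t ≤ ℓ :=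
    ⟨ht.1, ht.2.trans (min_le_right _ _)⟩
  rcases min_le_iff.1 htlow with htj | hℓt
  · have htj' : β / 2 * (1 / 2) ^ j ≤ t := le_of_eq_of_le (by ring) htj
    have ht0 : 0 ≤ t := htj'.trans' (by positivity)
    calc 3 * (c * ((1 / 2) ^ s) ^ j) = 3 * c * ((1 / 2) ^ s) ^ j := by ring
      _ ≤ α / β * (β / 2) ^ s * ((1 / 2) ^ s) ^ j := by gcongr
      _ = α / β * (β / 2 * (1 / 2) ^ j) ^ s := by
          rw [Real.mul_rpow (by positivity) (by positivity), Real.rpow_pow_comm one_half_pos.le,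
            mul_assoc]
      _ ≤ α / β * t ^ s := by gcongr
      _ ≤ α / β * (β / α * φ t) := by
          gcongr
          exact hφ t ⟨ht0, htℓ⟩
      _ = φ t := by field_simp
  · rw [le_antisymm htℓ hℓt]
    refine le_trans ?_ hcℓ
    gcongr
    exact mul_le_of_le_one_right hc <|
      pow_le_one₀ (by positivity) (Real.rpow_le_one one_half_pos.le one_half_lt_one.le hs)

/-- The chain cut out of a curve from `γ 0` to `γ ℓ` by the arc lengths `min (β 2⁻ʲ) ℓ`. -/
noncomputable def ContinuumChain.ofCurve {X : Type*} [PseudoMetricSpace X] {D : Set X} {γ : ℝ → X}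
    {β s c ℓ : ℝ} (hs : 1 ≤ s) (hc : 0 ≤ c) (hcβ : c ≤ β) (hℓ : 0 ≤ ℓ) (hℓβ : ℓ ≤ β)
    (hγ : LipschitzOnWith 1 γ (Icc 0 ℓ))
    (hD : ∀ j : ℕ, ∀ t ∈ Icc (min (β * (1 / 2) ^ (j + 1)) ℓ) (min (β * (1 / 2) ^ j) ℓ),
      ball (γ t) (3 * (c * ((1 / 2) ^ s) ^ j)) ⊆ D) :
    ContinuumChain D (γ ℓ) (γ 0) s c (4 * β) :=
  have hβ : 0 ≤ β := hc.trans hcβ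
  have hmono (j : ℕ) : min (β * (1 / 2) ^ (j + 1)) ℓ ≤ min (β * (1 / 2) ^ j) ℓ :=
    min_le_min_right _ <| mul_le_mul_of_nonneg_left
      (pow_le_pow_of_le_one one_half_pos.le one_half_lt_one.le j.le_succ) hβ
  have hsub (j : ℕ) : Icc (min (β * (1 / 2) ^ (j + 1)) ℓ) (min (β * (1 / 2) ^ j) ℓ) ⊆ Icc 0 ℓ :=
    Icc_subset_Icc (le_min (by positivity) hℓ) (min_le_right _ _)
  have hcont (j : ℕ) := hγ.continuousOn.mono (hsub j)
  have hdist (j : ℕ) {t : ℝ}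
      (ht : t ∈ Icc (min (β * (1 / 2) ^ (j + 1)) ℓ) (min (β * (1 / 2) ^ j) ℓ)) :
      dist (γ t) (γ 0) ≤ β * (1 / 2) ^ j := by
    have ht0 := hsub j ht
    have h := hγ.dist_le_mul t ht0 0 (left_mem_Icc.2 hℓ)
    rw [NNReal.coe_one, one_mul, Real.dist_eq, sub_zero, abs_of_nonneg ht0.1] at h
    exact h.trans (ht.2.trans (min_le_left _ _))
  { point := fun j => γ (min (β * (1 / 2) ^ j) ℓ)
    link := fun j => γ '' Icc (min (β * (1 / 2) ^ (j + 1)) ℓ) (min (β * (1 / 2) ^ j) ℓ)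
    point_zero := by simp [hℓβ]
    point_mem_link := fun j => mem_image_of_mem γ (right_mem_Icc.2 (hmono j))
    point_succ_mem_link := fun j => mem_image_of_mem γ (left_mem_Icc.2 (hmono j))
    isCompact_link := fun j => isCompact_Icc.image_of_continuousOn (hcont j)
    isPreconnected_link := fun j => isPreconnected_Icc.image γ (hcont j)
    ball_subset := by
      rintro j _ ⟨t, ht, rfl⟩
      refine subset_inter (ball_subset_ball' ?_) (hD j t ht)
      have hradius : c * ((1 / 2) ^ s) ^ j ≤ β * (1 / 2) ^ j := by
        gcongr
        exact half_rpow_le_half hs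
      linarith [hdist j ht]
    two_mul_dist_point_le := fun j => by
      have hpos : 0 ≤ β * (1 / 2) ^ j := by positivity
      linarith [hdist j (right_mem_Icc.2 (hmono j))] }

theorem IsJohnDomainWithCenter.exists_continuumChain {n : ℕ} (hn : n ≠ 0) {s : ℝ} (hs : 1 ≤ s)
    {D : Set (EuclideanSpace ℝ (Fin n))} {x₀ : EuclideanSpace ℝ (Fin n)}
    (hJ : IsJohnDomainWithCenter s D x₀) :
    ∃ c A : ℝ, 0 < c ∧ 2 * c ≤ A ∧ c ≤ infDist x₀ (frontier D) ∧
      ∀ x ∈ D, Nonempty (ContinuumChain D x₀ x s c A) := by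
  obtain ⟨hDo, -, hDb, hx₀, α, β, hα, hαβ, hcurve⟩ := hJ
  have : NeZero n := ⟨hn⟩
  have hβ : 0 < β := hα.trans_le hαβ
  have hδ := infDist_frontier_pos hDo hDb hx₀
  obtain ⟨c, hc, hcmin⟩ : ∃ c : ℝ, 0 < c ∧
      3 * c = min β (min (infDist x₀ (frontier D)) (α / β * (β / 2) ^ s)) :=
    ⟨min β (min (infDist x₀ (frontier D)) (α / β * (β / 2) ^ s)) / 3, by positivity,
      mul_div_cancel₀ _ three_ne_zero⟩
  obtain ⟨hcβ, hcδ, hcα⟩ : 3 * c ≤ β ∧ 3 * c ≤ infDist x₀ (frontier D) ∧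
      3 * c ≤ α / β * (β / 2) ^ s := by
    simpa only [le_min_iff] using hcmin.le
  refine ⟨c, 4 * β, hc, by linarith, by linarith, fun x hx => ?_⟩
  obtain ⟨ℓ, γ, hℓ, hℓβ, hγ, hγD, rfl, rfl, hdist⟩ := hcurve x hx
  refine ⟨.ofCurve hs hc.le (by linarith) hℓ hℓβ (lipschitzOnWith_one_of_hasUnitSpeedOn hγ)
    fun j t ht => ?_⟩
  have htℓ : t ∈ Icc 0 ℓ :=
    ⟨ht.1.trans' (le_min (by positivity) hℓ), ht.2.trans (min_le_right _ _)⟩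
  exact (ball_subset_ball (three_mul_le_of_rpow_le hα hβ (zero_le_one.trans hs) hc.le hcα hdist
    hcδ ht)).trans (ball_infDist_frontier_subset (hγD htℓ))

end JohnDomains

section PotentialBound

theorem sum_range_succ_pow_le_two_mul {a : ℝ≥0∞} (ha : 2 ≤ a) (J : ℕ) :
    ∑ j ∈ Finset.range (J + 1), a ^ j ≤ 2 * a ^ J := by
  induction J with
  | zero => simp
  | succ J ih =>
    calc ∑ j ∈ Finset.range (J + 1 + 1), a ^ j
        = ∑ j ∈ Finset.range (J + 1), a ^ j + a ^ (J + 1) := Finset.sum_range_succ _ _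
      _ ≤ a * a ^ J + a ^ (J + 1) := by gcongr; exact ih.trans (mul_le_mul_left ha _)
      _ = 2 * a ^ (J + 1) := by ring

-- The partial sums of a lacunary series are comparable with their last term, so that raising to the
-- power `q` may be done termwise.
theorem rpow_sum_indicator_pow_le {X : Type*} {a : ℝ≥0∞} (ha : 2 ≤ a) {q : ℝ} (hq : 0 < q)
    (B : ℕ → Set X) (y : X) (J : ℕ) :
    (∑ j ∈ Finset.range J, (B j).indicator (fun _ => a ^ j) y) ^ q
      ≤ ∑ j ∈ Finset.range J, (B j).indicator (fun _ => 2 ^ q * (a ^ q) ^ j) y := by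
  induction J with
  | zero => simp [hq]
  | succ J ih =>
    by_cases hy : y ∈ B J
    · calc (∑ j ∈ Finset.range (J + 1), (B j).indicator (fun _ => a ^ j) y) ^ q
          ≤ (∑ j ∈ Finset.range (J + 1), a ^ j) ^ q := by
            gcongr with j
            exact indicator_le_self' (fun _ _ => zero_le) y
        _ ≤ (2 * a ^ J) ^ q := by
            gcongr
            exact sum_range_succ_pow_le_two_mul ha J
        _ = (B J).indicator (fun _ => 2 ^ q * (a ^ q) ^ J) y := by
            rw [indicator_of_mem hy, ENNReal.mul_rpow_of_nonneg _ _ hq.le,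
              ← ENNReal.rpow_natCast_mul, ← ENNReal.rpow_mul_natCast, mul_comm q]
        _ ≤ _ := Finset.single_le_sum (f := fun j =>
            (B j).indicator (fun _ => 2 ^ q * (a ^ q) ^ j) y) (fun _ _ => zero_le)
            (Finset.self_mem_range_succ J)
    · simpa only [Finset.sum_range_succ, indicator_of_notMem hy, add_zero] using ih

theorem two_le_ofReal_two_rpow {d : ℝ} (hd : 1 ≤ d) : 2 ≤ ENNReal.ofReal (2 ^ d) := by
  rw [← ENNReal.ofReal_ofNat 2]
  exact ENNReal.ofReal_le_ofReal (Real.self_le_rpow_of_one_le one_le_two hd)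

theorem rpow_rpow_pow_one_div {a : ℝ≥0∞} {q : ℝ} (hq : 0 < q) (j : ℕ) :
    ((a ^ q) ^ j) ^ (1 / q) = a ^ j := by
  rw [← ENNReal.rpow_mul_natCast, ← ENNReal.rpow_mul, mul_one_div, mul_div_cancel_left₀ _ hq.ne',
    ENNReal.rpow_natCast]

variable {X : Type*} [PseudoMetricSpace X] [MeasurableSpace X] {d A p q : ℝ} {f : X → ℝ≥0∞}
  {μ : Measure X} {x : X} {W : ℝ≥0∞}

theorem pow_mul_measure_ball_dyadic_le {V : ℝ} (hA : 0 < A) (hq : 0 ≤ q)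
    (hμ : ∀ r, 0 < r → μ (ball x r) ≤ ENNReal.ofReal (V * r ^ (d * q))) (j : ℕ) :
    (ENNReal.ofReal (2 ^ d) ^ q) ^ j * μ (ball x (A * (1 / 2) ^ j))
      ≤ ENNReal.ofReal (V * A ^ (d * q)) := by
  have hhalf : ((2 : ℝ) ^ (d * q)) ^ j * ((1 / 2) ^ j) ^ (d * q) = 1 := by
    rw [← Real.rpow_natCast, ← Real.rpow_natCast (1 / 2), ← Real.rpow_mul two_pos.le,
      ← Real.rpow_mul one_half_pos.le, mul_comm (j : ℝ), ← Real.mul_rpow two_pos.le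
      one_half_pos.le]
    norm_num
  calc (ENNReal.ofReal (2 ^ d) ^ q) ^ j * μ (ball x (A * (1 / 2) ^ j))
      ≤ ENNReal.ofReal ((2 ^ (d * q)) ^ j)
          * ENNReal.ofReal (V * (A * (1 / 2) ^ j) ^ (d * q)) := by
        rw [ENNReal.ofReal_rpow_of_nonneg (by positivity) hq, ← Real.rpow_mul two_pos.le,
          ← ENNReal.ofReal_pow (by positivity)]
        exact mul_le_mul_right (hμ _ (by positivity)) _
    _ = ENNReal.ofReal (V * A ^ (d * q)) := by
        rw [← ENNReal.ofReal_mul (by positivity), Real.mul_rpow hA.le (by positivity)]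
        congr 1
        linear_combination V * A ^ (d * q) * hhalf

theorem sum_range_dyadicTerm_eq [OpensMeasurableSpace X] (hf : AEMeasurable f μ) (J : ℕ) :
    ∑ j ∈ Finset.range J, dyadicTerm d A f μ x j
      = ∫⁻ y, f y * ∑ j ∈ Finset.range J,
          (ball x (A * (1 / 2) ^ j)).indicator (fun _ => ENNReal.ofReal (2 ^ d) ^ j) y ∂μ := by
  simp only [Finset.mul_sum]
  rw [lintegral_finsetSum' (f := fun j y => f y *
      (ball x (A * (1 / 2) ^ j)).indicator (fun _ => ENNReal.ofReal (2 ^ d) ^ j) y) _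
    fun j _ => hf.mul (measurable_const.indicator measurableSet_ball).aemeasurable]
  refine Finset.sum_congr rfl fun j _ => ?_
  rw [dyadicTerm, ← lintegral_const_mul'' _ hf.restrict, ← lintegral_indicator measurableSet_ball]
  refine lintegral_congr fun y => ?_
  by_cases hy : y ∈ ball x (A * (1 / 2) ^ j) <;>
    simp only [hy, indicator_of_mem, indicator_of_notMem, not_false_eq_true, mul_zero, mul_comm]

theorem sum_range_dyadicTerm_le [OpensMeasurableSpace X] (hd : 1 ≤ d) (hpq : p.HolderConjugate q)
    (hf : AEMeasurable f μ)
    (hW : ∀ j : ℕ, (ENNReal.ofReal (2 ^ d) ^ q) ^ j * μ (ball x (A * (1 / 2) ^ j)) ≤ W) (J : ℕ) :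
    ∑ j ∈ Finset.range J, dyadicTerm d A f μ x j
      ≤ (∫⁻ y, f y ^ p ∂μ) ^ (1 / p) * (2 * W ^ (1 / q) * (J : ℝ≥0∞) ^ (1 / q)) := by
  have hq : 0 < q := hpq.symm.pos
  set B : ℕ → Set X := fun j => ball x (A * (1 / 2) ^ j)
  set a : ℝ≥0∞ := ENNReal.ofReal (2 ^ d)
  set k : X → ℝ≥0∞ := fun y => ∑ j ∈ Finset.range J, (B j).indicator (fun _ => a ^ j) y
  have hk : Measurable k :=
    Finset.measurable_sum _ fun j _ => measurable_const.indicator measurableSet_ball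
  have hkq : ∫⁻ y, k y ^ q ∂μ ≤ 2 ^ q * W * J := by
    calc ∫⁻ y, k y ^ q ∂μ
        ≤ ∫⁻ y, ∑ j ∈ Finset.range J, (B j).indicator (fun _ => 2 ^ q * (a ^ q) ^ j) y ∂μ :=
          lintegral_mono fun y =>
            rpow_sum_indicator_pow_le (two_le_ofReal_two_rpow hd) hq B y J
      _ = ∑ j ∈ Finset.range J, 2 ^ q * ((a ^ q) ^ j * μ (B j)) := by
          rw [lintegral_finsetSum _ fun j _ => measurable_const.indicator measurableSet_ball]
          refine Finset.sum_congr rfl fun j _ => ?_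
          rw [lintegral_indicator measurableSet_ball, setLIntegral_const, mul_assoc]
      _ ≤ ∑ j ∈ Finset.range J, 2 ^ q * W :=
          Finset.sum_le_sum fun j _ => mul_le_mul_right (hW j) _
      _ = 2 ^ q * W * J := by rw [Finset.sum_const, Finset.card_range, nsmul_eq_mul, mul_comm]
  calc ∑ j ∈ Finset.range J, dyadicTerm d A f μ x j
      = ∫⁻ y, f y * k y ∂μ := sum_range_dyadicTerm_eq hf J
    _ ≤ (∫⁻ y, f y ^ p ∂μ) ^ (1 / p) * (∫⁻ y, k y ^ q ∂μ) ^ (1 / q) :=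
        ENNReal.lintegral_mul_le_Lp_mul_Lq _ hpq hf hk.aemeasurable
    _ ≤ (∫⁻ y, f y ^ p ∂μ) ^ (1 / p) * (2 ^ q * W * J) ^ (1 / q) := by gcongr
    _ = _ := by
        rw [ENNReal.mul_rpow_of_nonneg _ _ (by positivity),
          ENNReal.mul_rpow_of_nonneg _ _ (by positivity), one_div q, ENNReal.rpow_rpow_inv hq.ne']

theorem dyadicTerm_le (hpq : p.HolderConjugate q) (hf : AEMeasurable f μ) {j : ℕ}
    (hW : (ENNReal.ofReal (2 ^ d) ^ q) ^ j * μ (ball x (A * (1 / 2) ^ j)) ≤ W) :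
    dyadicTerm d A f μ x j
      ≤ W ^ (1 / q) * (∫⁻ y in ball x (A * (1 / 2) ^ j), f y ^ p ∂μ) ^ (1 / p) := by
  have hq : 0 < q := hpq.symm.pos
  set B := ball x (A * (1 / 2) ^ j)
  have hHolder : ∫⁻ y in B, f y ∂μ ≤ (∫⁻ y in B, f y ^ p ∂μ) ^ (1 / p) * μ B ^ (1 / q) := by
    simpa only [Pi.mul_apply, mul_one, ENNReal.one_rpow, setLIntegral_const, one_mul] using
      ENNReal.lintegral_mul_le_Lp_mul_Lq (μ.restrict B) hpq hf.restrict
        (aemeasurable_const (b := (1 : ℝ≥0∞)))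
  calc dyadicTerm d A f μ x j
      ≤ ENNReal.ofReal (2 ^ d) ^ j * ((∫⁻ y in B, f y ^ p ∂μ) ^ (1 / p) * μ B ^ (1 / q)) :=
        mul_le_mul_right hHolder _
    _ = ((ENNReal.ofReal (2 ^ d) ^ q) ^ j * μ B) ^ (1 / q)
          * (∫⁻ y in B, f y ^ p ∂μ) ^ (1 / p) := by
        rw [ENNReal.mul_rpow_of_nonneg _ _ (by positivity), rpow_rpow_pow_one_div hq]
        ring
    _ ≤ _ := by gcongr

theorem tsum_dyadicTerm_add_le (hpq : p.HolderConjugate q) (hf : AEMeasurable f μ)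
    (hW : ∀ j : ℕ, (ENNReal.ofReal (2 ^ d) ^ q) ^ j * μ (ball x (A * (1 / 2) ^ j)) ≤ W)
    {θ : ℝ≥0∞} {J : ℕ}
    (hθ : ∀ k : ℕ, ∫⁻ y in ball x (A * (1 / 2) ^ (k + J)), f y ^ p ∂μ ≤ θ ^ k) :
    ∑' k, dyadicTerm d A f μ x (k + J) ≤ W ^ (1 / q) * (1 - θ ^ (1 / p))⁻¹ := by
  have hp : 0 < p := hpq.pos
  rw [← ENNReal.tsum_geometric, ← ENNReal.tsum_mul_left]
  refine ENNReal.tsum_le_tsum fun k => (dyadicTerm_le hpq hf (hW (k + J))).trans ?_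
  calc W ^ (1 / q) * (∫⁻ y in ball x (A * (1 / 2) ^ (k + J)), f y ^ p ∂μ) ^ (1 / p)
      ≤ W ^ (1 / q) * (θ ^ k) ^ (1 / p) := by gcongr; exact hθ k
    _ = W ^ (1 / q) * (θ ^ (1 / p)) ^ k := by
        rw [← ENNReal.rpow_natCast_mul, ← ENNReal.rpow_mul_natCast, mul_comm (k : ℝ)]

-- Hölder's inequality applied to the first `J` terms at once gives `J ^ (1 / q)` instead of `J`;
-- the remaining terms decay geometrically.
theorem dyadicPotential_le [OpensMeasurableSpace X] (hd : 1 ≤ d) (hpq : p.HolderConjugate q)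
    (hf : AEMeasurable f μ) (hfp : ∫⁻ y, f y ^ p ∂μ ≤ 1)
    (hW : ∀ j : ℕ, (ENNReal.ofReal (2 ^ d) ^ q) ^ j * μ (ball x (A * (1 / 2) ^ j)) ≤ W)
    {θ : ℝ≥0∞} {J : ℕ}
    (hθ : ∀ k : ℕ, ∫⁻ y in ball x (A * (1 / 2) ^ (k + J)), f y ^ p ∂μ ≤ θ ^ k) :
    dyadicPotential d A f μ x
      ≤ W ^ (1 / q) * (2 + (1 - θ ^ (1 / p))⁻¹) * ((J : ℝ≥0∞) + 1) ^ (1 / q) := by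
  have hp : 0 < p := hpq.pos
  have hq : 0 < q := hpq.symm.pos
  have hJ : 1 ≤ ((J : ℝ≥0∞) + 1) ^ (1 / q) := ENNReal.one_le_rpow le_add_self (by positivity)
  have hhead : ∑ j ∈ Finset.range J, dyadicTerm d A f μ x j
      ≤ 2 * W ^ (1 / q) * ((J : ℝ≥0∞) + 1) ^ (1 / q) := by
    refine (sum_range_dyadicTerm_le hd hpq hf hW J).trans ?_
    refine (mul_le_of_le_one_left' (ENNReal.rpow_le_one hfp (by positivity))).trans ?_
    gcongr
    exact le_self_add
  have htail : ∑' k, dyadicTerm d A f μ x (k + J)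
      ≤ W ^ (1 / q) * (1 - θ ^ (1 / p))⁻¹ * ((J : ℝ≥0∞) + 1) ^ (1 / q) :=
    (tsum_dyadicTerm_add_le hpq hf hW hθ).trans (le_mul_of_one_le_right' hJ)
  rw [dyadicPotential, ← ENNReal.summable.sum_add_tsum_nat_add' (k := J)]
  exact (add_le_add hhead htail).trans_eq (by ring)

end PotentialBound

section HausdorffContent

variable {n : ℕ} {d : ℝ}

theorem hausdorffContent_mono {E F : Set (EuclideanSpace ℝ (Fin n))} (h : E ⊆ F) :
    hausdorffContent d E ≤ hausdorffContent d F :=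
  le_iInf₂ fun x r => le_iInf fun hF => iInf₂_le_of_le x r (iInf_le_of_le (h.trans hF) le_rfl)

theorem hausdorffContent_le_tsum (hd : 0 < d) {ι : Type*} [Countable ι]
    {E : Set (EuclideanSpace ℝ (Fin n))} (x : ι → EuclideanSpace ℝ (Fin n)) (r : ι → ℝ≥0)
    (hE : E ⊆ ⋃ i, ball (x i) (r i)) :
    hausdorffContent d E ≤ ∑' i, (r i : ℝ≥0∞) ^ d := by
  obtain ⟨e, he⟩ := exists_injective_nat ι
  -- outside the range of `e`, the cover is continued by balls of radius `0`
  set r' : ℕ → ℝ≥0 := Function.extend e r 0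
  have hsupp : Function.support (fun k => (r' k : ℝ≥0∞) ^ d) ⊆ range e := by
    intro k hk
    by_contra hnot
    have hzero : r' k = 0 := Function.extend_apply' _ _ _ hnot
    exact hk (by simp [hzero, hd])
  refine iInf₂_le_of_le (Function.extend e x 0) r' (iInf_le_of_le ?_ ?_)
  · refine hE.trans (iUnion_subset fun i => subset_iUnion_of_subset (e i) ?_)
    simp only [r', he.extend_apply, subset_rfl]
  · rw [← he.tsum_eq hsupp]
    simp only [r', he.extend_apply, le_refl]

theorem hausdorffContent_ne_top_of_isBounded (hd : 0 < d) {E : Set (EuclideanSpace ℝ (Fin n))}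
    (hE : Bornology.IsBounded E) : hausdorffContent d E ≠ ⊤ := by
  obtain ⟨R, hR, hER⟩ := hE.subset_ball_lt 0 0
  refine ne_top_of_le_ne_top ?_ (hausdorffContent_le_tsum hd (ι := Unit) (fun _ => 0)
    (fun _ => ⟨R, hR.le⟩) (fun y hy => mem_iUnion.2 ⟨(), hER hy⟩))
  rw [tsum_fintype, Finset.univ_unique, Finset.sum_singleton]
  exact ENNReal.rpow_ne_top_of_nonneg hd.le ENNReal.coe_ne_top

end HausdorffContent

section Concentration

/-- The points around which `ν` concentrates in dimension `d` at some scale `r ≤ ε`, that is, where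
the `d`-dimensional fractional maximal function of `ν` over balls of radius at most `ε` exceeds
`ε⁻ᵈ`. -/
def concentrationSet {X : Type*} [PseudoMetricSpace X] [MeasurableSpace X] (ν : Measure X)
    (d ε : ℝ) : Set X :=
  {x | ∃ r ∈ Ioc 0 ε, ENNReal.ofReal ((r / ε) ^ d) < ν (ball x r)}

theorem one_div_pow_rpow {a d : ℝ} (ha : 0 ≤ a) (k : ℕ) :
    ((1 / a) ^ k) ^ d = ((a ^ d)⁻¹) ^ k := by
  rw [one_div, ← Real.rpow_pow_comm (inv_nonneg.2 ha), Real.inv_rpow ha]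

theorem measure_ball_dyadic_le_of_notMem_concentrationSet {X : Type*} [PseudoMetricSpace X]
    [MeasurableSpace X] {ν : Measure X} {d A : ℝ} (hA : 0 < A) {J : ℕ} {x : X}
    (hx : x ∉ concentrationSet ν d (A * (1 / 2) ^ J)) (k : ℕ) :
    ν (ball x (A * (1 / 2) ^ (k + J))) ≤ (ENNReal.ofReal (2 ^ d))⁻¹ ^ k := by
  have hscale : A * (1 / 2) ^ (k + J) / (A * (1 / 2) ^ J) = (1 / 2 : ℝ) ^ k := by
    rw [pow_add]
    field_simp
  have hmem : A * (1 / 2) ^ (k + J) ∈ Ioc 0 (A * (1 / 2) ^ J) :=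
    ⟨by positivity, mul_le_mul_of_nonneg_left
      (pow_le_pow_of_le_one one_half_pos.le one_half_lt_one.le (Nat.le_add_left J k)) hA.le⟩
  rw [← ENNReal.ofReal_inv_of_pos (by positivity), ← ENNReal.ofReal_pow (by positivity),
    ← one_div_pow_rpow two_pos.le, ← hscale]
  exact not_lt.1 fun hlt => hx ⟨_, hmem, hlt⟩

variable {n : ℕ} {d : ℝ}

theorem hausdorffContent_concentrationSet_le (hd : 0 < d)
    (ν : Measure (EuclideanSpace ℝ (Fin n))) {ε : ℝ} (hε : 0 < ε) :
    hausdorffContent d (concentrationSet ν d ε) ≤ ENNReal.ofReal ((4 * ε) ^ d) * ν univ := by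
  choose! r hr hν using fun x (hx : x ∈ concentrationSet ν d ε) => hx
  obtain ⟨U, hUE, hdisj, hcov⟩ := Vitali.exists_disjoint_subfamily_covering_enlargement_ball
    (concentrationSet ν d ε) id r ε (fun x hx => (hr x hx).2) 4 (by norm_num)
  have : Countable U := (hdisj.countable_of_isOpen (fun _ _ => isOpen_ball) fun x hx =>
    nonempty_ball.2 (hr x (hUE hx)).1).to_subtype
  have hcover : concentrationSet ν d ε ⊆ ⋃ x : U, ball (x : EuclideanSpace ℝ (Fin n))
      (4 * r x).toNNReal := by
    intro x hx
    obtain ⟨y, hy, hsub⟩ := hcov x hx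
    refine mem_iUnion.2 ⟨⟨y, hy⟩, ?_⟩
    rw [Real.coe_toNNReal _ (by linarith [(hr y (hUE hy)).1])]
    exact hsub (mem_ball_self (hr x hx).1)
  have hterm (x : U) : ((4 * r x).toNNReal : ℝ≥0∞) ^ d
      ≤ ENNReal.ofReal ((4 * ε) ^ d) * ν (ball x.1 (r x)) := by
    have hrx : 0 < r x := (hr x (hUE x.2)).1
    have hscale : 4 * r x = 4 * ε * (r x / ε) := by field_simp
    calc ((4 * r x).toNNReal : ℝ≥0∞) ^ d
        = ENNReal.ofReal ((4 * ε) ^ d) * ENNReal.ofReal ((r x / ε) ^ d) := by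
          rw [← ENNReal.ofReal, ENNReal.ofReal_rpow_of_pos (by positivity), hscale,
            Real.mul_rpow (by positivity) (by positivity), ENNReal.ofReal_mul (by positivity)]
      _ ≤ _ := mul_le_mul_right (hν x (hUE x.2)).le _
  calc hausdorffContent d (concentrationSet ν d ε)
      ≤ ∑' x : U, ((4 * r x).toNNReal : ℝ≥0∞) ^ d := hausdorffContent_le_tsum hd _ _ hcover
    _ ≤ ENNReal.ofReal ((4 * ε) ^ d) * ∑' x : U, ν (ball x.1 (r x)) := by
        rw [← ENNReal.tsum_mul_left]
        exact ENNReal.tsum_le_tsum hterm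
    _ ≤ ENNReal.ofReal ((4 * ε) ^ d) * ν univ := by
        gcongr
        exact tsum_measure_le_measure_univ (fun _ => measurableSet_ball.nullMeasurableSet)
          fun x y hxy => (hdisj x.2 y.2 (Subtype.coe_injective.ne hxy)).aedisjoint

theorem hausdorffContent_concentrationSet_dyadic_le (hd : 0 < d)
    {ν : Measure (EuclideanSpace ℝ (Fin n))} (hν : ν univ ≤ 1) {A : ℝ} (hA : 0 < A) (J : ℕ) :
    hausdorffContent d (concentrationSet ν d (A * (1 / 2) ^ J))
      ≤ ENNReal.ofReal ((4 * A) ^ d / (2 ^ d) ^ J) := by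
  refine (hausdorffContent_concentrationSet_le hd ν (by positivity)).trans
    ((mul_le_of_le_one_right' hν).trans_eq ?_)
  rw [← mul_assoc, Real.mul_rpow (by positivity) (by positivity),
    one_div_pow_rpow two_pos.le, inv_pow, div_eq_mul_inv]

end Concentration

section ExponentialIntegrability

theorem exp_log_div_mul_rpow_sq_le {L K q y : ℝ} (hL : 1 < L) (hK : 0 < K) (hq : 0 < q)
    {J : ℕ} (hy : 0 ≤ y) (hyK : y ≤ K * ((J : ℝ) + 1) ^ (1 / q)) :
    Real.exp (Real.log L / (2 * K ^ q) * y ^ q) ^ 2 ≤ L ^ (J + 1) := by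
  have hlog : 0 < Real.log L := Real.log_pos hL
  have hyq : y ^ q ≤ K ^ q * ((J : ℝ) + 1) := by
    refine (Real.rpow_le_rpow hy hyK hq.le).trans_eq ?_
    rw [Real.mul_rpow hK.le (by positivity), one_div, Real.rpow_inv_rpow (by positivity) hq.ne']
  rw [← Real.exp_nat_mul, ← Real.exp_log (one_pos.trans hL), ← Real.exp_nat_mul, Real.exp_le_exp,
    Real.exp_log (one_pos.trans hL)]
  calc ((2 : ℕ) : ℝ) * (Real.log L / (2 * K ^ q) * y ^ q)
      ≤ ((2 : ℕ) : ℝ) * (Real.log L / (2 * K ^ q) * (K ^ q * ((J : ℝ) + 1))) := by gcongr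
    _ = ((J + 1 : ℕ) : ℝ) * Real.log L := by
        push_cast
        field_simp

variable {n : ℕ} {d : ℝ} {D : Set (EuclideanSpace ℝ (Fin n))}
  {f : EuclideanSpace ℝ (Fin n) → ℝ}

theorem choquetIntegral_le_of_forall_hausdorffContent_le {Q : ℝ} (hQ : 0 ≤ Q)
    (h : ∀ t : ℝ, 0 < t → hausdorffContent d {x ∈ D | t < |f x|}
      ≤ ENNReal.ofReal (Q * (1 + t ^ 2)⁻¹)) :
    choquetIntegral d D f ≤ ENNReal.ofReal (Q * Real.pi) := by
  calc choquetIntegral d D f ≤ ∫⁻ t in Ioi (0 : ℝ), ENNReal.ofReal (Q * (1 + t ^ 2)⁻¹) :=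
        setLIntegral_mono' measurableSet_Ioi fun t ht => h t ht
    _ ≤ ∫⁻ t : ℝ, ENNReal.ofReal (Q * (1 + t ^ 2)⁻¹) := setLIntegral_le_lintegral _ _
    _ = ENNReal.ofReal (∫ t : ℝ, Q * (1 + t ^ 2)⁻¹) :=
        (ofReal_integral_eq_lintegral_ofReal (integrable_inv_one_add_sq.const_mul Q)
          (ae_of_all _ fun t => by positivity)).symm
    _ = ENNReal.ofReal (Q * Real.pi) := by rw [integral_const_mul, integral_univ_inv_one_add_sq]

theorem hausdorffContent_superlevel_le {L M H : ℝ} (hL : 1 < L) (hM : 0 ≤ M) (hH : 0 ≤ H)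
    (hDH : hausdorffContent d D ≤ ENNReal.ofReal H) {E : ℕ → Set (EuclideanSpace ℝ (Fin n))}
    (hE : ∀ J, hausdorffContent d (E J) ≤ ENNReal.ofReal (M / L ^ J))
    (hf : ∀ J, ∀ x ∈ D, x ∉ E J → f x ^ 2 ≤ L ^ (J + 1)) {t : ℝ} (ht : 0 < t) :
    hausdorffContent d {x ∈ D | t < |f x|}
      ≤ ENNReal.ofReal ((H * (1 + L) + 2 * M * L ^ 2) * (1 + t ^ 2)⁻¹) := by
  have hL0 : 0 < L := one_pos.trans hL
  have hHL : 0 ≤ H * (1 + L) := by positivity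
  have hML : 0 ≤ 2 * M * L ^ 2 := by positivity
  rcases lt_or_ge (t ^ 2) L with hsmall | hlarge
  · refine (hausdorffContent_mono (sep_subset _ _)).trans
      (hDH.trans (ENNReal.ofReal_le_ofReal ?_))
    rw [← div_eq_mul_inv, le_div_iff₀ (by positivity)]
    linarith [mul_le_mul_of_nonneg_left hsmall.le hH]
  · obtain ⟨J, hJt, htJ⟩ := exists_nat_pow_near ((one_le_div hL0).2 hlarge) hL
    rw [le_div_iff₀ hL0, ← pow_succ] at hJt
    rw [div_lt_iff₀ hL0] at htJ
    have hsub : {x ∈ D | t < |f x|} ⊆ E J := by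
      rintro x ⟨hxD, hx⟩
      by_contra hxE
      exact (hf J x hxD hxE).not_gt (hJt.trans_lt (sq_lt_sq.2 (by rwa [abs_of_pos ht])))
    refine (hausdorffContent_mono hsub).trans ((hE J).trans (ENNReal.ofReal_le_ofReal ?_))
    rw [← div_eq_mul_inv, div_le_div_iff₀ (by positivity) (by positivity)]
    have htJ' : 1 + t ^ 2 ≤ 2 * (L ^ 2 * L ^ J) := by
      linarith [show L ^ (J + 1) * L = L ^ 2 * L ^ J by ring]
    calc M * (1 + t ^ 2) ≤ M * (2 * (L ^ 2 * L ^ J)) := by gcongr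
      _ = 2 * M * L ^ 2 * L ^ J := by ring
      _ ≤ (H * (1 + L) + 2 * M * L ^ 2) * L ^ J := by
          gcongr
          exact le_add_of_nonneg_left hHL

theorem exists_choquetIntegral_exp_le (hd : 0 < d) (hD : Bornology.IsBounded D) {L M K q : ℝ}
    (hL : 1 < L) (hM : 0 < M) (hK : 0 < K) (hq : 0 < q) :
    ∃ a b : ℝ, 0 < a ∧ 0 < b ∧ ∀ (E : ℕ → Set (EuclideanSpace ℝ (Fin n)))
      (f : EuclideanSpace ℝ (Fin n) → ℝ),
      (∀ J, hausdorffContent d (E J) ≤ ENNReal.ofReal (M / L ^ J)) →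
      (∀ J : ℕ, ∀ x ∈ D, x ∉ E J → |f x| ≤ K * ((J : ℝ) + 1) ^ (1 / q)) →
      choquetIntegral d D (fun x => Real.exp (a * |f x| ^ q)) ≤ ENNReal.ofReal b := by
  set H : ℝ := (hausdorffContent d D).toReal
  have hH : 0 ≤ H := ENNReal.toReal_nonneg
  have hDH : hausdorffContent d D ≤ ENNReal.ofReal H :=
    (ENNReal.ofReal_toReal (hausdorffContent_ne_top_of_isBounded hd hD)).ge
  refine ⟨Real.log L / (2 * K ^ q), (H * (1 + L) + 2 * M * L ^ 2) * Real.pi,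
    div_pos (Real.log_pos hL) (by positivity), by positivity, fun E f hE hf => ?_⟩
  exact choquetIntegral_le_of_forall_hausdorffContent_le (by positivity) fun t ht =>
    hausdorffContent_superlevel_le hL hM.le hH hDH hE
      (fun J x hx hxE => exp_log_div_mul_rpow_sq_le hL hK hq (abs_nonneg _) (hf J x hx hxE)) ht

end ExponentialIntegrability

section IntegralBounds

theorem holderConjugate_div_sub_div {m d : ℝ} (hd : 0 < d) (hdm : d < m) :
    (m / (m - d)).HolderConjugate (m / d) := by
  have hm : 0 < m := hd.trans hdm
  rw [Real.holderConjugate_iff]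
  refine ⟨(one_lt_div (sub_pos.2 hdm)).2 (sub_lt_self m hd), ?_⟩
  rw [inv_div, inv_div, ← add_div, sub_add_cancel, div_self hm.ne']

variable {X F : Type*} [MeasurableSpace X] [NormedAddCommGroup F] {μ : Measure X} {f : X → F}
  {p : ℝ}

theorem lintegral_enorm_rpow_le_one_of_eLpNorm_le_one (hp : 0 < p)
    (hf : eLpNorm f (ENNReal.ofReal p) μ ≤ 1) : ∫⁻ x, ‖f x‖ₑ ^ p ∂μ ≤ 1 := by
  rw [eLpNorm_eq_eLpNorm' (ENNReal.ofReal_pos.2 hp).ne' ENNReal.ofReal_ne_top,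
    ENNReal.toReal_ofReal hp.le] at hf
  rw [lintegral_rpow_enorm_eq_rpow_eLpNorm' hp]
  exact ENNReal.rpow_le_one hf hp.le

theorem lintegral_enorm_le_of_eLpNorm_le_one (hp : 1 ≤ p) (hfm : AEStronglyMeasurable f μ)
    (hf : eLpNorm f (ENNReal.ofReal p) μ ≤ 1) :
    ∫⁻ x, ‖f x‖ₑ ∂μ ≤ μ univ ^ (1 - 1 / p) := by
  have hHolder := eLpNorm_le_eLpNorm_mul_rpow_measure_univ (ENNReal.one_le_ofReal.2 hp) hfm
  rw [eLpNorm_one_eq_lintegral_enorm, ENNReal.toReal_one, div_one,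
    ENNReal.toReal_ofReal (one_pos.trans_le hp).le] at hHolder
  exact hHolder.trans (mul_le_of_le_one_left' hf)

end IntegralBounds

section PointwiseBound

theorem exists_dyadicPotential_le_of_notMem_concentrationSet {X : Type*} [PseudoMetricSpace X]
    [MeasurableSpace X] [OpensMeasurableSpace X] {μ : Measure X} {d A V p q : ℝ} (hd : 1 ≤ d)
    (hA : 0 < A) (hpq : p.HolderConjugate q)
    (hμ : ∀ x r, 0 < r → μ (ball x r) ≤ ENNReal.ofReal (V * r ^ (d * q))) :
    ∃ C : ℝ≥0∞, C ≠ ⊤ ∧ ∀ f : X → ℝ≥0∞, AEMeasurable f μ → ∫⁻ y, f y ^ p ∂μ ≤ 1 →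
      ∀ (J : ℕ) (x : X),
        x ∉ concentrationSet (μ.withDensity fun y => f y ^ p) d (A * (1 / 2) ^ J) →
        dyadicPotential d A f μ x ≤ C * ((J : ℝ≥0∞) + 1) ^ (1 / q) := by
  have hp : 0 < p := hpq.pos
  have hq : 0 < q := hpq.symm.pos
  set θ : ℝ≥0∞ := (ENNReal.ofReal (2 ^ d))⁻¹
  have hθ : θ < 1 :=
    ENNReal.inv_lt_one.2 (ENNReal.one_lt_two.trans_le (two_le_ofReal_two_rpow hd))
  have hθp : θ ^ (1 / p) < 1 := ENNReal.rpow_lt_one hθ (by positivity)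
  refine ⟨ENNReal.ofReal (V * A ^ (d * q)) ^ (1 / q) * (2 + (1 - θ ^ (1 / p))⁻¹),
    ENNReal.mul_ne_top (ENNReal.rpow_ne_top_of_nonneg (by positivity) ENNReal.ofReal_ne_top)
      (ENNReal.add_ne_top.2
        ⟨ENNReal.ofNat_ne_top, ENNReal.inv_ne_top.2 (tsub_pos_of_lt hθp).ne'⟩),
    fun f hf hfp J x hx => ?_⟩
  refine dyadicPotential_le hd hpq hf hfp (pow_mul_measure_ball_dyadic_le hA hq.le (hμ x))
    fun k => ?_
  rw [← withDensity_apply _ measurableSet_ball]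
  exact measure_ball_dyadic_le_of_notMem_concentrationSet hA hx k

theorem abs_sub_le_of_edist_le {a b q : ℝ} {T : ℝ≥0∞} (hT : T ≠ ⊤) (hq : 0 ≤ q) {J : ℕ}
    (h : edist a b ≤ T * ((J : ℝ≥0∞) + 1) ^ (1 / q)) :
    |a - b| ≤ T.toReal * ((J : ℝ) + 1) ^ (1 / q) := by
  have htop : T * ((J : ℝ≥0∞) + 1) ^ (1 / q) ≠ ⊤ :=
    ENNReal.mul_ne_top hT (ENNReal.rpow_ne_top_of_nonneg (by positivity) (by simp))
  have hreal := ENNReal.toReal_mono htop h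
  rwa [← dist_edist, Real.dist_eq, ENNReal.toReal_mul, ← ENNReal.toReal_rpow,
    ENNReal.toReal_add (by simp) (by simp), ENNReal.toReal_natCast, ENNReal.toReal_one] at hreal

variable {n : ℕ} {s : ℝ} {D : Set (EuclideanSpace ℝ (Fin n))} {x₀ : EuclideanSpace ℝ (Fin n)}

theorem volume_restrict_ball_le {d q : ℝ} (hdq : d * q = n) (D : Set (EuclideanSpace ℝ (Fin n)))
    (x : EuclideanSpace ℝ (Fin n)) (r : ℝ) (hr : 0 < r) :
    volume.restrict D (ball x r) ≤ ENNReal.ofReal (unitBallVolume n * r ^ (d * q)) := by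
  rw [hdq, Real.rpow_natCast, mul_comm, ← volume_ball_eq x hr]
  exact Measure.restrict_apply_le D _

theorem IsPreciseRepresentativeOn.edist_average_le {u v : EuclideanSpace ℝ (Fin n) → ℝ}
    {g : EuclideanSpace ℝ (Fin n) → EuclideanSpace ℝ (Fin n)} {x : EuclideanSpace ℝ (Fin n)}
    {c A R : ℝ} {C M N : ℝ≥0∞} (hv : IsPreciseRepresentativeOn D u v)
    (h : HasWeakGradientOn D u g) (hDo : IsOpen D) (hx : x ∈ D) (hn : 2 ≤ n) (hs : 1 ≤ s)
    (hc : 0 < c) (hcA : 2 * c ≤ A) (hcR : c ≤ R) (hR : ball x₀ R ⊆ D)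
    (γ : ContinuumChain D x₀ x s c A) (hM : ∫⁻ y in D, ‖g y‖ₑ ≤ M) (hC : C ≠ ⊤) (hN : 1 ≤ N)
    (hNtop : N ≠ ⊤) (hpot : dyadicPotential (s * ((n : ℝ) - 1)) A (fun y => ‖g y‖ₑ)
      (volume.restrict D) x ≤ C * N) :
    edist (v x) (⨍ y in ball x₀ R, u y) ≤ (ENNReal.ofReal (continuumChainConst n s c) * C
      + ENNReal.ofReal (poincareConst n * (R / c ^ n)) * M) * N := by
  obtain ⟨b, hb, hbc⟩ := γ.exists_tendsto_average_abs_sub h hDo hx hn hs hc hcA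
    (ne_top_of_le_ne_top (ENNReal.mul_ne_top hC hNtop) hpot)
  have hcenter : edist (⨍ y in ball x₀ c, u y) (⨍ y in ball x₀ R, u y)
      ≤ ENNReal.ofReal (poincareConst n * (R / c ^ n)) * M :=
    (h.edist_average_le hc hR (ball_subset_ball hcR)).trans
      (mul_le_mul_right ((lintegral_mono_set hR).trans hM) _)
  rw [hv x hx b hb, add_mul, mul_assoc]
  exact (edist_triangle _ (⨍ y in ball x₀ c, u y) _).trans (add_le_add
    (hbc.trans (mul_le_mul_right hpot _)) (hcenter.trans (le_mul_of_one_le_right' hN)))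

theorem IsJohnDomainWithCenter.exists_abs_sub_average_le (hJ : IsJohnDomainWithCenter s D x₀)
    (hn : 2 ≤ n) (hs : 1 ≤ s) {p q : ℝ} (hpq : p.HolderConjugate q)
    (hdq : s * ((n : ℝ) - 1) * q = n) :
    ∃ A K : ℝ, 0 < A ∧ 0 < K ∧ ∀ (u : EuclideanSpace ℝ (Fin n) → ℝ)
      (g : EuclideanSpace ℝ (Fin n) → EuclideanSpace ℝ (Fin n)), HasWeakGradientOn D u g →
      eLpNorm g (ENNReal.ofReal p) (volume.restrict D) ≤ 1 →
      IntegrableOn u (ball x₀ (infDist x₀ (frontier D))) ∧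
      ∀ v : EuclideanSpace ℝ (Fin n) → ℝ, IsPreciseRepresentativeOn D u v → ∀ J : ℕ, ∀ x ∈ D,
        x ∉ concentrationSet ((volume.restrict D).withDensity fun y => ‖g y‖ₑ ^ p)
          (s * ((n : ℝ) - 1)) (A * (1 / 2) ^ J) →
        |v x - ⨍ y in ball x₀ (infDist x₀ (frontier D)), u y|
          ≤ K * ((J : ℝ) + 1) ^ (1 / q) := by
  have hq : 0 < q := hpq.symm.pos
  have hnR : (2 : ℝ) ≤ n := by exact_mod_cast hn
  obtain ⟨c, A, hc, hcA, hcR, hchain⟩ := hJ.exists_continuumChain (by lia) hs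
  obtain ⟨hDo, -, hDb, hx₀, -⟩ := hJ
  have hA : 0 < A := by linarith
  obtain ⟨C, hC, hpotential⟩ := exists_dyadicPotential_le_of_notMem_concentrationSet
    (d := s * ((n : ℝ) - 1)) (by nlinarith) hA hpq (volume_restrict_ball_le hdq D)
  set R := infDist x₀ (frontier D)
  have hRD : ball x₀ R ⊆ D := ball_infDist_frontier_subset hx₀
  set M : ℝ≥0∞ := volume D ^ (1 - 1 / p)
  have hM : M ≠ ⊤ := ENNReal.rpow_ne_top_of_nonneg
    (sub_nonneg.2 (by simpa only [one_div] using inv_le_one_of_one_le₀ hpq.lt.le))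
    hDb.measure_lt_top.ne
  set T : ℝ≥0∞ := ENNReal.ofReal (continuumChainConst n s c) * C
    + ENNReal.ofReal (poincareConst n * (R / c ^ n)) * M
  have hT : T ≠ ⊤ := ENNReal.add_ne_top.2
    ⟨ENNReal.mul_ne_top ENNReal.ofReal_ne_top hC, ENNReal.mul_ne_top ENNReal.ofReal_ne_top hM⟩
  refine ⟨A, T.toReal + 1, hA, by positivity, fun u g h hg => ?_⟩
  have hgm : AEStronglyMeasurable g (volume.restrict D) := h.2.1.aestronglyMeasurable
  have hgM : ∫⁻ y in D, ‖g y‖ₑ ≤ M := by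
    simpa only [Measure.restrict_apply_univ] using
      lintegral_enorm_le_of_eLpNorm_le_one hpq.lt.le hgm hg
  refine ⟨h.integrableOn_ball hRD
    (ne_top_of_le_ne_top hM ((lintegral_mono_set hRD).trans hgM)), fun v hv J x hx hxE => ?_⟩
  have hpot := hpotential _ hgm.enorm
    (lintegral_enorm_rpow_le_one_of_eLpNorm_le_one hpq.pos hg) J x hxE
  obtain ⟨γ⟩ := hchain x hx
  have hedist := hv.edist_average_le h hDo hx hn hs hc hcA hcR hRD γ hgM hC
    (ENNReal.one_le_rpow le_add_self (by positivity))
    (ENNReal.rpow_ne_top_of_nonneg (by positivity) (by simp)) hpot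
  refine (abs_sub_le_of_edist_le hT hq.le hedist).trans ?_
  gcongr
  exact le_add_of_nonneg_right zero_le_one

end PointwiseBound

theorem corollary1p2 (n : ℕ) (hn : 2 ≤ n) (s : ℝ) (hs1 : 1 ≤ s) (hs2 : s < (n : ℝ) / ((n : ℝ) - 1))
    (D : Set (EuclideanSpace ℝ (Fin n))) (x₀ : EuclideanSpace ℝ (Fin n))
    (hD : IsJohnDomainWithCenter s D x₀) :
    ∃ a b : ℝ, 0 < a ∧ 0 < b ∧
      ∀ (u : EuclideanSpace ℝ (Fin n) → ℝ)
        (g : EuclideanSpace ℝ (Fin n) → EuclideanSpace ℝ (Fin n)),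
        HasWeakGradientOn D u g →
        eLpNorm g (ENNReal.ofReal ((n : ℝ) / ((n : ℝ) - s * ((n : ℝ) - 1))))
          (volume.restrict D) ≤ 1 →
        IntegrableOn u (ball x₀ (infDist x₀ (frontier D))) ∧
        ∀ v : EuclideanSpace ℝ (Fin n) → ℝ, IsPreciseRepresentativeOn D u v →
          choquetIntegral (s * ((n : ℝ) - 1)) D
            (fun x => Real.exp (a *
              |v x - ⨍ y in ball x₀ (infDist x₀ (frontier D)), u y|
                ^ ((n : ℝ) / (s * ((n : ℝ) - 1))))) ≤ ENNReal.ofReal b := by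
  have hnR : (2 : ℝ) ≤ n := by exact_mod_cast hn
  have hd : 0 < s * ((n : ℝ) - 1) := by nlinarith
  have hdn : s * ((n : ℝ) - 1) < n := by rwa [lt_div_iff₀ (by linarith)] at hs2
  have hpq := holderConjugate_div_sub_div hd hdn
  obtain ⟨A, K, hA, hK, hpointwise⟩ :=
    hD.exists_abs_sub_average_le hn hs1 hpq (mul_div_cancel₀ _ hd.ne')
  obtain ⟨a, b, ha, hb, hexp⟩ := exists_choquetIntegral_exp_le hd hD.2.2.1
    (Real.one_lt_rpow one_lt_two hd) (M := (4 * A) ^ (s * ((n : ℝ) - 1))) (by positivity) hK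
    hpq.symm.pos
  refine ⟨a, b, ha, hb, fun u g h hg => ?_⟩
  obtain ⟨hu, hv⟩ := hpointwise u g h hg
  refine ⟨hu, fun v hvu => hexp _ _ (fun J => ?_) (hv v hvu)⟩
  refine hausdorffContent_concentrationSet_dyadic_le hd ?_ hA J
  rw [withDensity_apply _ MeasurableSet.univ, setLIntegral_univ]
  exact lintegral_enorm_rpow_le_one_of_eLpNorm_le_one hpq.pos hg
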